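/- Let $\pi:M\to S$ be an elliptic bundle: $M$ is a compact complex surface, $S$ is a compact Riemann surface of genus at least $2$, and $\pi$ is a holomorphic fiber bundle with fiber an elliptic curve $E=\mathbb{C}/\Lambda$. Let $\omega_S$ be the Kähler metric on $S$ with $\mathrm{Ric}(\omega_S)=-\omega_S$, and write $\omega_S$ also for its pull-back $\pi^*\omega_S$ to $M$. Let $\omega_0$ be a Gauduchon metric on $M$, that is, a Hermitian metric with $\partial\overline{\partial}\omega_0=0$. Let $\rho$ be a smooth real function on $M$ such that $\omega_{\mathrm{flat}}:=\omega_0+\sqrt{-1}\,\partial\overline{\partial}\rho$ restricts to a flat Kähler metric on every fiber $E_y=\pi^{-1}(y)$, $y\in S$. For $t\in\mathbb{R}$ put $$\tilde\omega=\tilde\omega(t)=e^{-t}\omega_{\mathrm{flat}}+(1-e^{-t})\,\omega_S ,$$ and let $T_I\in\mathbb{R}$ be such that $\tilde\omega(t)$ is positive definite on $M$ for all $t\ge T_I$. For $t\ge T_I$ let $\tilde g=\tilde g(t)$ be the Hermitian metric on $M$ with $\tilde\omega=\sqrt{-1}\,\tilde g_{i\bar j}\,dz^i\wedge d\bar z^j$,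 and let $\tilde\nabla=(\tilde\nabla_i)$ and $\overline{\tilde\nabla}=(\tilde\nabla_{\bar i})$ be the $(1,0)$ and $(0,1)$ parts of its Chern connection, with Christoffel symbols $\tilde\Gamma^k_{ij}=\tilde g^{k\bar q}\partial_i\tilde g_{j\bar q}$. Let $\tilde T^k_{ij}=\tilde\Gamma^k_{ij}-\tilde\Gamma^k_{ji}$ be its torsion, $\overline{\partial}\tilde T$ the tensor $\partial_{\bar\ell}\tilde T^k_{ij}=\tilde\nabla_{\bar\ell}\tilde T^k_{ij}$, and $\widetilde{\mathrm{Rm}}$ its Chern curvature $\tilde R_{k\bar\ell i}{}^{p}=-\partial_{\bar\ell}\tilde\Gamma^p_{ki}$. Then there is a constant $C$, independent of $t$ and of the point of $M$, such that for all $t\ge T_I$, everywhere on $M$, 1. $|\tilde T|_{\tilde g}\le C$; 2. $|\overline{\partial}\tilde T|_{\tilde g}+|\tilde\nabla\tilde T|_{\tilde g}+|\widetilde{\mathrm{Rm}}|_{\tilde g}\le Ce^{t/2}$; 3. $|\overline{\tilde\nabla}\,\overline{\partial}\tilde T|_{\tilde g}+|\tilde\nabla\overline{\partial}\tilde T|_{\tilde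 g}\le Ce^{t}$. -/

import Mathlib

open scoped ContDiff Manifold ComplexOrder
open Bundle

noncomputable section

namespace CollapsingSurfaces

/-! ### Hermitian geometry in holomorphic coordinates -/

/-- The Wirtinger derivative `∂_i f = ∂f/∂z^i = (∂f/∂x^i - √-1 ∂f/∂y^i) / 2`. -/
def wirt {n : ℕ} (i : Fin n) (f : (Fin n → ℂ) → ℂ) (z : Fin n → ℂ) : ℂ :=
  (1 / 2) * (fderiv ℝ f z (Pi.single i 1) - Complex.I * fderiv ℝ f z (Pi.single i Complex.I))

/-- The Wirtinger derivative `∂_ī f = ∂f/∂z̄^i = (∂f/∂x^i + √-1 ∂f/∂y^i) / 2`. -/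
def wirtBar {n : ℕ} (i : Fin n) (f : (Fin n → ℂ) → ℂ) (z : Fin n → ℂ) : ℂ :=
  (1 / 2) * (fderiv ℝ f z (Pi.single i 1) + Complex.I * fderiv ℝ f z (Pi.single i Complex.I))

/-- The coefficients `∂_i ∂_j̄ u` of the form `√-1 ∂∂̄u = √-1 (∂_i ∂_j̄ u) dz^i ∧ dz̄^j`. -/
def leviForm {n : ℕ} (u : (Fin n → ℂ) → ℝ) (z : Fin n → ℂ) : Matrix (Fin n) (Fin n) ℂ :=
  Matrix.of fun i j => wirt i (wirtBar j fun w => (u w : ℂ)) z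

/-- The four kinds of indices of a tensor on a complex manifold: `X^i`, `X_i`, `X^ī`, `X_ī`. -/
inductive Slot where
  | upper
  | lower
  | upperBar
  | lowerBar

/-- The coefficients in a holomorphic coordinate system of a field of tensors with `m` indices. -/
abbrev TensorField (n m : ℕ) : Type := (Fin n → ℂ) → (Fin m → Fin n) → ℂ

/-- The coefficients `g_{i j̄}` of a `(1,1)`-form `√-1 g_{i j̄} dz^i ∧ dz̄^j` in a holomorphic
coordinate system; the row index is the unbarred one. -/
abbrev FormCoeff (n : ℕ) : Type := (Fin n → ℂ) → Matrix (Fin n) (Fin n) ℂ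

/-- The Hermitian matrix by which a metric with matrix `G = (g_{i j̄})` contracts an index of `A`
with the same index of `conj A`. The inverse metric `g^{i j̄}`, determined by
`g^{i q̄} g_{j q̄} = δ^i_j`, is the entry of `G⁻¹` in row `j` and column `i`. -/
def Slot.gram {n : ℕ} (G : Matrix (Fin n) (Fin n) ℂ) : Slot → Matrix (Fin n) (Fin n) ℂ
  | .upper => G
  | .lower => (G⁻¹).transpose
  | .upperBar => G.transpose
  | .lowerBar => G⁻¹

/-- The norm `|A|_g` of a tensor with index kinds `κ`; for instance
`|T|_g² = g_{k c̄} g^{i ā} g^{j b̄} T^k_{ij} conj(T^c_{ab})`. -/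
def tensorNorm {n m : ℕ} (G : Matrix (Fin n) (Fin n) ℂ) (κ : Fin m → Slot)
    (A : (Fin m → Fin n) → ℂ) : ℝ :=
  Real.sqrt (∑ I : Fin m → Fin n, ∑ J : Fin m → Fin n,
    (∏ s, (κ s).gram G (I s) (J s)) * A I * (starRingEnd ℂ) (A J)).re

/-- The Christoffel symbols `Γ^k_{ij} = g^{k q̄} ∂_i g_{j q̄}` of the Chern connection. -/
def christoffel {n : ℕ} (G : FormCoeff n) (z : Fin n → ℂ) (k i j : Fin n) : ℂ :=
  ∑ q, (G z)⁻¹ q k * wirt i (fun w => G w j q) z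

/-- The `(1,0)`-part `∇_p A` of the Chern covariant derivative of a tensor field with index
kinds `κ`; the new index `p` (of kind `Slot.lower`) comes first. -/
def nabla {n m : ℕ} (G : FormCoeff n) (κ : Fin m → Slot) (A : TensorField n m) :
    TensorField n (m + 1) := fun z J =>
  wirt (J 0) (fun w => A w (Fin.tail J)) z +
    ∑ s : Fin m, match κ s with
      | .upper => ∑ r, christoffel G z (Fin.tail J s) (J 0) r *
          A z (Function.update (Fin.tail J) s r)
      | .lower => -∑ r, christoffel G z r (J 0) (Fin.tail J s) *
          A z (Function.update (Fin.tail J) s r)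
      | .upperBar => 0
      | .lowerBar => 0

/-- The `(0,1)`-part `∇_p̄ A` of the Chern covariant derivative of a tensor field with index
kinds `κ`; the new index `p̄` (of kind `Slot.lowerBar`) comes first. On a tensor without barred
indices this is `∂_p̄ A`. -/
def nablaBar {n m : ℕ} (G : FormCoeff n) (κ : Fin m → Slot) (A : TensorField n m) :
    TensorField n (m + 1) := fun z J =>
  wirtBar (J 0) (fun w => A w (Fin.tail J)) z +
    ∑ s : Fin m, match κ s with
      | .upper => 0
      | .lower => 0
      | .upperBar => ∑ r, (starRingEnd ℂ) (christoffel G z (Fin.tail J s) (J 0) r) *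
          A z (Function.update (Fin.tail J) s r)
      | .lowerBar => -∑ r, (starRingEnd ℂ) (christoffel G z r (J 0) (Fin.tail J s)) *
          A z (Function.update (Fin.tail J) s r)

/-- The torsion `T^k_{ij} = Γ^k_{ij} - Γ^k_{ji}`, with indices in the order `k, i, j`. -/
def torsion {n : ℕ} (G : FormCoeff n) : TensorField n 3 := fun z I =>
  christoffel G z (I 0) (I 1) (I 2) - christoffel G z (I 0) (I 2) (I 1)

def torsionSlots : Fin 3 → Slot := ![.upper, .lower, .lower]

/-- The Chern curvature `R_{k l̄ i}^p = -∂_l̄ Γ^p_{ki}`, with indices in the order `k, l, i, p`. -/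
def chernCurvature {n : ℕ} (G : FormCoeff n) : TensorField n 4 := fun z I =>
  -wirtBar (I 1) (fun w => christoffel G w (I 3) (I 0) (I 2)) z

def curvatureSlots : Fin 4 → Slot := ![.lower, .lowerBar, .lower, .upper]

/-- The Chern-Ricci curvature `R_{k l̄} = R_{k l̄ i}^i`. -/
def chernRicci {n : ℕ} (G : FormCoeff n) : FormCoeff n := fun z =>
  Matrix.of fun k l => ∑ i, chernCurvature G z ![k, l, i, i]

/-- `|T|_g`. -/
def torsionNorm {n : ℕ} (G : FormCoeff n) (z : Fin n → ℂ) : ℝ :=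
  tensorNorm (G z) torsionSlots (torsion G z)

/-- `|∂̄T|_g`, where `∂̄T` is the tensor `∂_l̄ T^k_{ij} = ∇_l̄ T^k_{ij}`. -/
def dbarTorsionNorm {n : ℕ} (G : FormCoeff n) (z : Fin n → ℂ) : ℝ :=
  tensorNorm (G z) (Fin.cons .lowerBar torsionSlots : Fin 4 → Slot)
    (nablaBar G torsionSlots (torsion G) z)

/-- `|∇T|_g`. -/
def nablaTorsionNorm {n : ℕ} (G : FormCoeff n) (z : Fin n → ℂ) : ℝ :=
  tensorNorm (G z) (Fin.cons .lower torsionSlots : Fin 4 → Slot)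
    (nabla G torsionSlots (torsion G) z)

/-- `|Rm|_g`. -/
def curvatureNorm {n : ℕ} (G : FormCoeff n) (z : Fin n → ℂ) : ℝ :=
  tensorNorm (G z) curvatureSlots (chernCurvature G z)

/-- `|∇̄∂̄T|_g`. -/
def nablaBarDbarTorsionNorm {n : ℕ} (G : FormCoeff n) (z : Fin n → ℂ) : ℝ :=
  tensorNorm (G z)
    (Fin.cons .lowerBar (Fin.cons .lowerBar torsionSlots : Fin 4 → Slot) : Fin 5 → Slot)
    (nablaBar G (Fin.cons .lowerBar torsionSlots : Fin 4 → Slot)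
      (nablaBar G torsionSlots (torsion G)) z)

/-- `|∇∂̄T|_g`. -/
def nablaDbarTorsionNorm {n : ℕ} (G : FormCoeff n) (z : Fin n → ℂ) : ℝ :=
  tensorNorm (G z)
    (Fin.cons .lower (Fin.cons .lowerBar torsionSlots : Fin 4 → Slot) : Fin 5 → Slot)
    (nabla G (Fin.cons .lowerBar torsionSlots : Fin 4 → Slot)
      (nablaBar G torsionSlots (torsion G)) z)

/-! ### Hermitian metrics on complex manifolds -/

/-- The holomorphic coordinate charts of an `n`-dimensional complex manifold. -/
abbrev holCharts (n : ℕ) (M : Type*) [TopologicalSpace M] [ChartedSpace (Fin n → ℂ) M] :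
    Set (OpenPartialHomeomorph M (Fin n → ℂ)) :=
  IsManifold.maximalAtlas 𝓘(ℂ, Fin n → ℂ) ω M

/-- A smooth Hermitian metric on an `n`-dimensional complex manifold: a positive definite form on
each holomorphic tangent space, linear in the first and conjugate linear in the second argument,
whose coefficients in each holomorphic chart are real-smooth functions. -/
structure HermitianMetric (n : ℕ) (M : Type*) [TopologicalSpace M] [ChartedSpace (Fin n → ℂ) M] where
  form : ∀ x : M, TangentSpace 𝓘(ℂ, Fin n → ℂ) x →ₗ[ℂ] TangentSpace 𝓘(ℂ, Fin n → ℂ) x →ₗ⋆[ℂ] ℂ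
  conj_symm : ∀ x v w, (starRingEnd ℂ) (form x v w) = form x w v
  pos : ∀ x v, v ≠ 0 → 0 < (form x v v).re
  smooth : ∀ e ∈ holCharts n M, ∀ i j : Fin n, ContDiffOn ℝ ∞ (fun z : Fin n → ℂ =>
    form (e.symm z)
      (mfderiv 𝓘(ℂ, Fin n → ℂ) 𝓘(ℂ, Fin n → ℂ) e.symm z (Pi.single i (1 : ℂ) : Fin n → ℂ))
      (mfderiv 𝓘(ℂ, Fin n → ℂ) 𝓘(ℂ, Fin n → ℂ) e.symm z (Pi.single j (1 : ℂ) : Fin n → ℂ)))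
    e.target

section

variable {n : ℕ} {M : Type*} [TopologicalSpace M] [ChartedSpace (Fin n → ℂ) M]

/-- The coefficients of the pull-back of the metric (or of its `(1,1)`-form) under a holomorphic
map `f` from an open set of `ℂᵐ` to `M`. For the inverse `f = e.symm` of a holomorphic chart these
are the coefficients `g_{i j̄}` of the metric in this chart. -/
def HermitianMetric.pull (h : HermitianMetric n M) {m : ℕ} (f : (Fin m → ℂ) → M) : FormCoeff m :=
  fun z => Matrix.of fun i j =>
    h.form (f z)
      (mfderiv 𝓘(ℂ, Fin m → ℂ) 𝓘(ℂ, Fin n → ℂ) f z (Pi.single i (1 : ℂ) : Fin m → ℂ))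
      (mfderiv 𝓘(ℂ, Fin m → ℂ) 𝓘(ℂ, Fin n → ℂ) f z (Pi.single j (1 : ℂ) : Fin m → ℂ))

/-- The condition `∂∂̄ω = 0` on the associated form `ω` of a Hermitian metric. In complex dimension
two this says that the metric is Gauduchon. -/
def HermitianMetric.DdbarClosed (h : HermitianMetric n M) : Prop :=
  ∀ e ∈ holCharts n M, ∀ z ∈ e.target, ∀ i j k l : Fin n,
    wirt k (wirtBar l fun w => h.pull e.symm w i j) z
      - wirt i (wirtBar l fun w => h.pull e.symm w k j) z
      - wirt k (wirtBar j fun w => h.pull e.symm w i l) z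
      + wirt i (wirtBar j fun w => h.pull e.symm w k l) z = 0

/-- `Ric(ω) = -ω`. On a Riemann surface, where every Hermitian metric is Kähler, this is the
Kähler-Einstein equation. -/
def HermitianMetric.RicciEqNeg (h : HermitianMetric n M) : Prop :=
  ∀ e ∈ holCharts n M, ∀ z ∈ e.target, chernRicci (h.pull e.symm) z = -h.pull e.symm z

/-- The coefficients of the pull-back under a holomorphic map `f` of `ω₀ + √-1 ∂∂̄ρ`. -/
def flatForm (g₀ : HermitianMetric n M) (ρ : M → ℝ) {m : ℕ} (f : (Fin m → ℂ) → M) :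
    FormCoeff m :=
  fun z => g₀.pull f z + leviForm (fun w => ρ (f w)) z

/-- The restriction of `ω₀ + √-1 ∂∂̄ρ` to each fiber of `pr` (a smooth holomorphic curve) is a flat
Kähler metric: in each local holomorphic parametrization `γ` of an open piece of a fiber it is
positive and has zero curvature. -/
def IsFlatOnFibers {S : Type*} (pr : M → S) (g₀ : HermitianMetric n M) (ρ : M → ℝ) : Prop :=
  ∀ (y : S) (D : Set (Fin 1 → ℂ)) (γ : (Fin 1 → ℂ) → M), IsOpen D →
    ContMDiffOn 𝓘(ℂ, Fin 1 → ℂ) 𝓘(ℂ, Fin n → ℂ) ω γ D →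
    (∀ ζ ∈ D, pr (γ ζ) = y ∧
      Function.Injective (mfderiv 𝓘(ℂ, Fin 1 → ℂ) 𝓘(ℂ, Fin n → ℂ) γ ζ)) →
    ∀ ζ ∈ D, (flatForm g₀ ρ γ ζ).PosDef ∧ chernCurvature (flatForm g₀ ρ γ) ζ = 0

/-- The coefficients in the holomorphic chart `e` of the reference form
`ω̃(t) = e⁻ᵗ ω_flat + (1 - e⁻ᵗ) pr^*ω_S`, where `ω_flat = ω₀ + √-1 ∂∂̄ρ`. -/
def refForm {k : ℕ} {S : Type*} [TopologicalSpace S] [ChartedSpace (Fin k → ℂ) S] (pr : M → S)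
    (g₀ : HermitianMetric n M) (ρ : M → ℝ) (gS : HermitianMetric k S) (t : ℝ)
    (e : OpenPartialHomeomorph M (Fin n → ℂ)) : FormCoeff n :=
  fun z => (Real.exp (-t) : ℂ) • flatForm g₀ ρ e.symm z
    + (1 - Real.exp (-t) : ℂ) • gS.pull (fun w => pr (e.symm w)) z

end

/-! ### Elliptic bundles -/

/-- `E` is an elliptic curve, that is, biholomorphic to `ℂ / Λ` for a lattice `Λ ⊂ ℂ`: there is a
surjective local biholomorphism `ℂ → E` whose fibers are the cosets of `Λ`. -/
def IsEllipticCurve (E : Type*) [TopologicalSpace E] [ChartedSpace ℂ E] : Prop :=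
  ∃ (Λ : Submodule ℤ ℂ) (_ : DiscreteTopology Λ) (_ : IsZLattice ℝ Λ) (p : ℂ → E),
    IsLocalDiffeomorph 𝓘(ℂ, ℂ) 𝓘(ℂ, ℂ) ω p ∧ Function.Surjective p ∧
      ∀ z w : ℂ, p z = p w ↔ z - w ∈ Λ

/-- `pr : M → S` is a holomorphic fiber bundle with fiber the elliptic curve `E`, where `M` is a
complex surface and `S` is a Riemann surface: `S` is covered by open sets over which `pr` is
biholomorphic to the product projection with fiber `E`. -/
def IsEllipticBundle (E : Type*) [TopologicalSpace E] [ChartedSpace ℂ E]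
    {M S : Type*} [TopologicalSpace M] [ChartedSpace (Fin 2 → ℂ) M]
    [TopologicalSpace S] [ChartedSpace (Fin 1 → ℂ) S] (pr : M → S) : Prop :=
  IsEllipticCurve E ∧ ∀ y : S, ∃ φ : Trivialization E pr, y ∈ φ.baseSet ∧
    ContMDiffOn 𝓘(ℂ, Fin 2 → ℂ) (𝓘(ℂ, Fin 1 → ℂ).prod 𝓘(ℂ, ℂ)) ω φ φ.source ∧
    ContMDiffOn (𝓘(ℂ, Fin 1 → ℂ).prod 𝓘(ℂ, ℂ)) 𝓘(ℂ, Fin 2 → ℂ) ω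
      φ.toOpenPartialHomeomorph.symm φ.target

end CollapsingSurfaces

end

open CollapsingSurfaces

/-!
The norms in question do not depend on the holomorphic chart, so they may be computed in
coordinates adapted to the bundle and to the time. Over a chart of the base with coordinate `z`,
composing a local trivialization with the universal covering `ℂ → ℂ / Λ` of the fiber gives a
locally biholomorphic parametrization `Ψ (z, w)` of `M` (`IsFiberParam`). Put `s = e^{-t/2}` and
use the coordinates `(z, s w)`. There the coefficients of `ω̃(t)` are
`s² h₀₀ + (1 - s²) σ`, `s h₀₁`, `s h₁₀`, `h₁₁` (`scaledForm`), where `h` and `σ` are the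
coefficients of `ω_flat` and `ω_S` as functions of `(z, w)`. As functions of `(s, z, w)` they are
smooth, and nondegenerate up to `s = 0`, but a derivative in the rescaled fiber direction is
`s⁻¹ ∂_w`.

The point is that the Christoffel symbols nevertheless stay bounded. The function `σ` depends on
`z` only, the coefficients containing `h₀₀`, `h₀₁` and `h₁₀` carry a factor `s`, and `h₁₁` does not
depend on `w`: for a flat metric on `ℂ / Λ` the Christoffel symbol is a bounded entire function,
hence constant, and it vanishes where the coefficient is maximal (`wirt_eq_zero_of_flat`). So the
Christoffel symbols extend smoothly to `s = 0`, and so does the torsion. Every further derivative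
costs at most one factor `s⁻¹ = e^{t/2}`; this is the calculus of `HasOrder`, and it gives the
orders `0`, `1`, `2` of the three estimates (`IsCollapsing.exists_tensorNorm_bound`). Bounds that
are uniform in `s` and locally uniform on `M` follow from the compactness of the interval of
parameters `s`, and global ones from the compactness of `M`.

The independence of the chart is proved for tensors with any number of indices: torsion and
curvature transform as tensors, covariant differentiation preserves tensors, and norms are
invariant (`isCoordTensor_torsion`, `isCoordTensor_chernCurvature`, `IsCoordTensor.nabla`,
`IsCoordTensor.nablaBar`, `tensorNorm_slotTransform`).
-/

open scoped Topology

noncomputable section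

namespace CollapsingSurfaces

/-! ### Wirtinger calculus -/

section Wirtinger

variable {n m : ℕ} {f g : (Fin n → ℂ) → ℂ} {z : Fin n → ℂ} {i j : Fin n}

/-- A vector of `ℂⁿ` as a real combination of the coordinate vectors `∂/∂xⁱ` and `∂/∂yⁱ`. -/
theorem eq_sum_single_one_add_single_I (v : Fin n → ℂ) :
    v = ∑ i, ((v i).re • (Pi.single i (1 : ℂ) : Fin n → ℂ) +
      (v i).im • (Pi.single i Complex.I : Fin n → ℂ)) := by
  ext k
  rw [Finset.sum_apply, Finset.sum_eq_single k]
  · simp [Complex.re_add_im]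
  · intro b _ hb
    simp [Pi.single_eq_of_ne hb.symm]
  · simp

theorem real_linear_eq_sum (L : (Fin n → ℂ) →L[ℝ] ℂ) (v : Fin n → ℂ) :
    L v = ∑ i, ((1 / 2) * (L (Pi.single i 1) - Complex.I * L (Pi.single i Complex.I)) * v i +
      (1 / 2) * (L (Pi.single i 1) + Complex.I * L (Pi.single i Complex.I)) *
        (starRingEnd ℂ) (v i)) := by
  conv_lhs => rw [eq_sum_single_one_add_single_I v]
  rw [map_sum]
  refine Finset.sum_congr rfl fun i _ => ?_
  rw [map_add, map_smul, map_smul, Complex.real_smul, Complex.real_smul]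
  set a := v i
  have h1 : (a.re : ℂ) = (a + (starRingEnd ℂ) a) / 2 := by
    rw [Complex.add_conj]; push_cast; ring
  have h2 : (a.im : ℂ) = -Complex.I * (a - (starRingEnd ℂ) a) / 2 := by
    rw [Complex.sub_conj]; push_cast
    linear_combination (a.im : ℂ) * Complex.I_mul_I
  rw [h1, h2]
  ring

/-- The differential of `f` is `∑ (∂_i f dz^i + ∂_ī f dz̄^i)`. -/
theorem fderiv_eq_sum_wirt (f : (Fin n → ℂ) → ℂ) (z v : Fin n → ℂ) :
    fderiv ℝ f z v = ∑ i, (wirt i f z * v i + wirtBar i f z * (starRingEnd ℂ) (v i)) :=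
  real_linear_eq_sum _ v

theorem wirt_congr (h : f =ᶠ[𝓝 z] g) : wirt i f z = wirt i g z := by
  unfold wirt; rw [h.fderiv_eq]

theorem wirtBar_congr (h : f =ᶠ[𝓝 z] g) : wirtBar i f z = wirtBar i g z := by
  unfold wirtBar; rw [h.fderiv_eq]

theorem wirtBar_eventuallyEq (h : f =ᶠ[𝓝 z] g) : wirtBar i f =ᶠ[𝓝 z] wirtBar i g :=
  h.eventuallyEq_nhds.mono fun _ hw => wirtBar_congr hw

@[simp] theorem wirt_const (c : ℂ) : wirt i (fun _ => c) z = 0 := by simp [wirt]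

theorem wirt_add (hf : DifferentiableAt ℝ f z) (hg : DifferentiableAt ℝ g z) :
    wirt i (fun w => f w + g w) z = wirt i f z + wirt i g z := by
  simp only [wirt, fderiv_fun_add hf hg, add_apply]; ring

theorem wirtBar_add (hf : DifferentiableAt ℝ f z) (hg : DifferentiableAt ℝ g z) :
    wirtBar i (fun w => f w + g w) z = wirtBar i f z + wirtBar i g z := by
  simp only [wirtBar, fderiv_fun_add hf hg, add_apply]; ring

theorem wirt_sum {ι : Type*} (s : Finset ι) {F : ι → (Fin n → ℂ) → ℂ}
    (h : ∀ a ∈ s, DifferentiableAt ℝ (F a) z) :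
    wirt i (fun w => ∑ a ∈ s, F a w) z = ∑ a ∈ s, wirt i (F a) z := by
  simp only [wirt, fderiv_fun_sum h, sum_apply, Finset.mul_sum,
    Finset.sum_sub_distrib, mul_sub]

theorem wirtBar_sum {ι : Type*} (s : Finset ι) {F : ι → (Fin n → ℂ) → ℂ}
    (h : ∀ a ∈ s, DifferentiableAt ℝ (F a) z) :
    wirtBar i (fun w => ∑ a ∈ s, F a w) z = ∑ a ∈ s, wirtBar i (F a) z := by
  simp only [wirtBar, fderiv_fun_sum h, sum_apply, Finset.mul_sum,
    Finset.sum_add_distrib, mul_add]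

theorem wirt_mul (hf : DifferentiableAt ℝ f z) (hg : DifferentiableAt ℝ g z) :
    wirt i (fun w => f w * g w) z = wirt i f z * g z + f z * wirt i g z := by
  simp only [wirt, fderiv_fun_mul hf hg, add_apply,
    smul_apply, smul_eq_mul]; ring

theorem wirtBar_mul (hf : DifferentiableAt ℝ f z) (hg : DifferentiableAt ℝ g z) :
    wirtBar i (fun w => f w * g w) z = wirtBar i f z * g z + f z * wirtBar i g z := by
  simp only [wirtBar, fderiv_fun_mul hf hg, add_apply,
    smul_apply, smul_eq_mul]; ring

theorem wirt_const_mul (c : ℂ) (hf : DifferentiableAt ℝ f z) :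
    wirt i (fun w => c * f w) z = c * wirt i f z := by
  rw [wirt_mul (differentiableAt_const c) hf, wirt_const]; ring

theorem wirt_finset_prod {ι : Type*} [DecidableEq ι] (s : Finset ι) {F : ι → (Fin n → ℂ) → ℂ}
    (h : ∀ a ∈ s, DifferentiableAt ℝ (F a) z) :
    wirt i (fun w => ∏ a ∈ s, F a w) z =
      ∑ a ∈ s, (∏ b ∈ s.erase a, F b z) * wirt i (F a) z := by
  have := (HasFDerivAt.finsetProd fun a ha => (h a ha).hasFDerivAt).fderiv
  simp only [wirt, this, sum_apply, smul_apply,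
    smul_eq_mul, Finset.mul_sum, ← Finset.sum_sub_distrib]
  exact Finset.sum_congr rfl fun a _ => by ring

theorem differentiableAt_conj (hf : DifferentiableAt ℝ f z) :
    DifferentiableAt ℝ (fun w => (starRingEnd ℂ) (f w)) z :=
  Complex.conjCLE.differentiableAt.comp z hf

theorem fderiv_conj_apply (hf : DifferentiableAt ℝ f z) (v : Fin n → ℂ) :
    fderiv ℝ (fun w => (starRingEnd ℂ) (f w)) z v = (starRingEnd ℂ) (fderiv ℝ f z v) := by
  have := (Complex.conjCLE.hasFDerivAt.comp z hf.hasFDerivAt).fderiv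
  change fderiv ℝ (Complex.conjCLE ∘ f) z v = _
  rw [this]; rfl

theorem wirt_conj (hf : DifferentiableAt ℝ f z) :
    wirt i (fun w => (starRingEnd ℂ) (f w)) z = (starRingEnd ℂ) (wirtBar i f z) := by
  simp only [wirt, wirtBar, fderiv_conj_apply hf, map_mul, map_add, Complex.conj_I,
    map_div₀, map_one, Complex.conj_ofNat]
  ring

theorem fderiv_real_eq (hf : DifferentiableAt ℂ f z) (v : Fin n → ℂ) :
    fderiv ℝ f z v = fderiv ℂ f z v := by
  rw [hf.fderiv_restrictScalars ℝ]; rfl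

theorem single_I_eq (i : Fin n) :
    (Pi.single i Complex.I : Fin n → ℂ) = Complex.I • (Pi.single i (1 : ℂ) : Fin n → ℂ) := by
  rw [← Pi.single_smul]; simp

theorem wirt_of_holomorphic (hf : DifferentiableAt ℂ f z) :
    wirt i f z = fderiv ℂ f z (Pi.single i 1) := by
  rw [wirt, fderiv_real_eq hf, fderiv_real_eq hf, single_I_eq, map_smul, smul_eq_mul]
  linear_combination (-(1 / 2) * fderiv ℂ f z (Pi.single i 1)) * Complex.I_mul_I

theorem wirtBar_of_holomorphic (hf : DifferentiableAt ℂ f z) : wirtBar i f z = 0 := by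
  rw [wirtBar, fderiv_real_eq hf, fderiv_real_eq hf, single_I_eq, map_smul, smul_eq_mul]
  linear_combination ((1 / 2) * fderiv ℂ f z (Pi.single i 1)) * Complex.I_mul_I

theorem contDiffAt_wirt (hf : ContDiffAt ℝ ∞ f z) : ContDiffAt ℝ ∞ (wirt i f) z := by
  have h := hf.fderiv_right (m := ∞) (by simp)
  exact contDiffAt_const.mul ((h.clm_apply contDiffAt_const).sub
    (contDiffAt_const.mul (h.clm_apply contDiffAt_const)))

theorem contDiffAt_wirtBar (hf : ContDiffAt ℝ ∞ f z) : ContDiffAt ℝ ∞ (wirtBar i f) z := by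
  have h := hf.fderiv_right (m := ∞) (by simp)
  exact contDiffAt_const.mul ((h.clm_apply contDiffAt_const).add
    (contDiffAt_const.mul (h.clm_apply contDiffAt_const)))

theorem contDiffAt_conj (hf : ContDiffAt ℝ ∞ f z) :
    ContDiffAt ℝ ∞ (fun w => (starRingEnd ℂ) (f w)) z :=
  Complex.conjCLE.contDiff.contDiffAt.comp z hf

theorem differentiableAt_of_contDiffAt (hf : ContDiffAt ℝ ∞ f z) : DifferentiableAt ℝ f z :=
  hf.differentiableAt (by simp)

end Wirtinger

/-! ### Holomorphic changes of coordinates -/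

section Jacobian

variable {n m : ℕ} {Φ : (Fin m → ℂ) → (Fin n → ℂ)} {z : Fin m → ℂ}

/-- The holomorphic Jacobian matrix `∂Φ^a/∂z^i` of `Φ : ℂᵐ → ℂⁿ`; the row index is `a`. -/
def jac (Φ : (Fin m → ℂ) → (Fin n → ℂ)) (z : Fin m → ℂ) : Matrix (Fin n) (Fin m) ℂ :=
  Matrix.of fun a i => fderiv ℂ Φ z (Pi.single i 1) a

theorem fderiv_single (Φ : (Fin m → ℂ) → (Fin n → ℂ)) (z : Fin m → ℂ) (i : Fin m) :
    fderiv ℂ Φ z (Pi.single i 1) = ∑ a, jac Φ z a i • (Pi.single a (1 : ℂ) : Fin n → ℂ) := by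
  ext b
  rw [Finset.sum_apply, Finset.sum_eq_single b]
  · simp [jac]
  · intro a _ ha
    simp [Pi.single_eq_of_ne ha.symm]
  · simp

theorem fderiv_real_comp {f : (Fin n → ℂ) → ℂ} (hf : DifferentiableAt ℝ f (Φ z))
    (hΦ : DifferentiableAt ℂ Φ z) (v : Fin m → ℂ) :
    fderiv ℝ (fun w => f (Φ w)) z v = fderiv ℝ f (Φ z) (fderiv ℂ Φ z v) := by
  have := (hf.hasFDerivAt.comp z (hΦ.hasFDerivAt.restrictScalars ℝ)).fderiv
  change fderiv ℝ (f ∘ Φ) z v = _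
  rw [this]; rfl

theorem fderiv_single_I (Φ : (Fin m → ℂ) → (Fin n → ℂ)) (z : Fin m → ℂ) (i : Fin m) (a : Fin n) :
    fderiv ℂ Φ z (Pi.single i Complex.I) a = Complex.I * jac Φ z a i := by
  rw [single_I_eq, map_smul, jac]; rfl

theorem wirt_comp {f : (Fin n → ℂ) → ℂ} (hf : DifferentiableAt ℝ f (Φ z))
    (hΦ : DifferentiableAt ℂ Φ z) (i : Fin m) :
    wirt i (fun w => f (Φ w)) z = ∑ a, wirt a f (Φ z) * jac Φ z a i := by
  rw [wirt, fderiv_real_comp hf hΦ, fderiv_real_comp hf hΦ, fderiv_eq_sum_wirt,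
    fderiv_eq_sum_wirt, Finset.mul_sum, ← Finset.sum_sub_distrib, Finset.mul_sum]
  refine Finset.sum_congr rfl fun a _ => ?_
  rw [fderiv_single_I]
  change 1 / 2 * (_ * jac Φ z a i + _ * (starRingEnd ℂ) (jac Φ z a i) - _) = _
  rw [map_mul, Complex.conj_I]
  linear_combination (-(1 / 2) * (wirt a f (Φ z) * jac Φ z a i) +
    (1 / 2) * (wirtBar a f (Φ z) * (starRingEnd ℂ) (jac Φ z a i))) * Complex.I_mul_I

theorem wirtBar_comp {f : (Fin n → ℂ) → ℂ} (hf : DifferentiableAt ℝ f (Φ z))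
    (hΦ : DifferentiableAt ℂ Φ z) (i : Fin m) :
    wirtBar i (fun w => f (Φ w)) z =
      ∑ a, wirtBar a f (Φ z) * (starRingEnd ℂ) (jac Φ z a i) := by
  rw [wirtBar, fderiv_real_comp hf hΦ, fderiv_real_comp hf hΦ, fderiv_eq_sum_wirt,
    fderiv_eq_sum_wirt, Finset.mul_sum, ← Finset.sum_add_distrib, Finset.mul_sum]
  refine Finset.sum_congr rfl fun a _ => ?_
  rw [fderiv_single_I]
  change 1 / 2 * (_ * jac Φ z a i + _ * (starRingEnd ℂ) (jac Φ z a i) + _) = _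
  rw [map_mul, Complex.conj_I]
  linear_combination ((1 / 2) * (wirt a f (Φ z) * jac Φ z a i) -
    (1 / 2) * (wirtBar a f (Φ z) * (starRingEnd ℂ) (jac Φ z a i))) * Complex.I_mul_I

theorem contDiffAt_jac (hΦ : ContDiffAt ℂ ω Φ z) (a : Fin n) (i : Fin m) :
    ContDiffAt ℂ ω (fun w => jac Φ w a i) z := by
  have h := hΦ.fderiv_right (m := ω) (by simp)
  exact contDiffAt_pi.1 (h.clm_apply contDiffAt_const) a

theorem contDiffAt_real_of_complex {E F : Type*} [NormedAddCommGroup E] [NormedSpace ℂ E]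
    [NormedAddCommGroup F] [NormedSpace ℂ F] {f : E → F} {x : E} (hf : ContDiffAt ℂ ω f x) :
    ContDiffAt ℝ ∞ f x := (hf.restrict_scalars ℝ).of_le (by simp)

theorem differentiableAt_of_omega {E F : Type*} [NormedAddCommGroup E] [NormedSpace ℂ E]
    [NormedAddCommGroup F] [NormedSpace ℂ F] {f : E → F} {x : E} (hf : ContDiffAt ℂ ω f x) :
    DifferentiableAt ℂ f x := hf.differentiableAt (by simp)

theorem contDiffAt_jac_real (hΦ : ContDiffAt ℂ ω Φ z) (a : Fin n) (i : Fin m) :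
    ContDiffAt ℝ ∞ (fun w => jac Φ w a i) z :=
  contDiffAt_real_of_complex (contDiffAt_jac hΦ a i)

theorem wirtBar_jac (hΦ : ContDiffAt ℂ ω Φ z) (a : Fin n) (i p : Fin m) :
    wirtBar p (fun w => jac Φ w a i) z = 0 :=
  wirtBar_of_holomorphic (differentiableAt_of_omega (contDiffAt_jac hΦ a i))

theorem wirt_conj_jac (hΦ : ContDiffAt ℂ ω Φ z) (a : Fin n) (i p : Fin m) :
    wirt p (fun w => (starRingEnd ℂ) (jac Φ w a i)) z = 0 := by
  rw [wirt_conj (differentiableAt_of_contDiffAt (contDiffAt_jac_real hΦ a i)), wirtBar_jac hΦ,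
    map_zero]

/-- The second derivatives of a holomorphic map are symmetric. -/
theorem wirt_jac_symm (hΦ : ContDiffAt ℂ ω Φ z) (a : Fin n) (i p : Fin m) :
    wirt p (fun w => jac Φ w a i) z = wirt i (fun w => jac Φ w a p) z := by
  have hs : IsSymmSndFDerivAt ℂ Φ z := hΦ.isSymmSndFDerivAt (by simp)
  have hd : DifferentiableAt ℂ (fderiv ℂ Φ) z :=
    differentiableAt_of_omega (hΦ.fderiv_right (m := ω) (by simp))
  have key : ∀ i p : Fin m, wirt p (fun w => jac Φ w a i) z =
      fderiv ℂ (fderiv ℂ Φ) z (Pi.single p 1) (Pi.single i 1) a := by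
    intro i p
    rw [wirt_of_holomorphic (differentiableAt_of_omega (contDiffAt_jac hΦ a i))]
    have h1 := (hd.hasFDerivAt.clm_apply
      (hasFDerivAt_const (Pi.single i (1 : ℂ) : Fin m → ℂ) z))
    have h2 := ((hasFDerivAt_pi'.1 h1) a).fderiv
    change fderiv ℂ (fun w => fderiv ℂ Φ w (Pi.single i 1) a) z _ = _
    rw [h2]
    simp
  rw [key, key, hs.eq]

theorem jac_comp {l : ℕ} {Ψ : (Fin l → ℂ) → (Fin m → ℂ)} {u : Fin l → ℂ}
    (hΦ : DifferentiableAt ℂ Φ (Ψ u)) (hΨ : DifferentiableAt ℂ Ψ u) :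
    jac (fun w => Φ (Ψ w)) u = jac Φ (Ψ u) * jac Ψ u := by
  ext a i
  have h1 : fderiv ℂ (fun w => Φ (Ψ w)) u = (fderiv ℂ Φ (Ψ u)).comp (fderiv ℂ Ψ u) :=
    fderiv_comp u hΦ hΨ
  rw [Matrix.mul_apply]
  change fderiv ℂ (fun w => Φ (Ψ w)) u (Pi.single i 1) a = _
  rw [h1, ContinuousLinearMap.comp_apply, fderiv_single, map_sum, Finset.sum_apply]
  refine Finset.sum_congr rfl fun b _ => ?_
  rw [map_smul, Pi.smul_apply, smul_eq_mul, mul_comm]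
  rfl

theorem jac_congr {Ψ : (Fin m → ℂ) → (Fin n → ℂ)} (h : Φ =ᶠ[𝓝 z] Ψ) : jac Φ z = jac Ψ z := by
  unfold jac; rw [h.fderiv_eq]

end Jacobian

/-! ### Tensors under a linear change of frame -/

section Algebra

variable {n m : ℕ}

/-- The matrix by which one index of the given kind transforms under a change of coordinates with
Jacobian matrix `J`; the row index is the new one, the column index the old one. -/
def slotMat (J : Matrix (Fin n) (Fin n) ℂ) : Slot → Matrix (Fin n) (Fin n) ℂ
  | .upper => J⁻¹
  | .lower => J.transpose
  | .upperBar => J⁻¹.map (starRingEnd ℂ)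
  | .lowerBar => J.transpose.map (starRingEnd ℂ)

/-- The components of a tensor after a change of coordinates with Jacobian matrix `J`. -/
def slotTransform (J : Matrix (Fin n) (Fin n) ℂ) (κ : Fin m → Slot) (A : (Fin m → Fin n) → ℂ)
    (I : Fin m → Fin n) : ℂ :=
  ∑ K : Fin m → Fin n, (∏ s, slotMat J (κ s) (I s) (K s)) * A K

theorem map_conj_inv (J : Matrix (Fin n) (Fin n) ℂ) (hJ : IsUnit J.det) :
    (J.map (starRingEnd ℂ))⁻¹ = J⁻¹.map (starRingEnd ℂ) := by
  apply Matrix.inv_eq_left_inv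
  rw [← Matrix.map_mul, Matrix.nonsing_inv_mul _ hJ]
  simp

theorem isUnit_det_map_conj {J : Matrix (Fin n) (Fin n) ℂ} (hJ : IsUnit J.det) :
    IsUnit (J.map (starRingEnd ℂ)).det := by
  have : (J.map (starRingEnd ℂ)).det = (starRingEnd ℂ) J.det :=
    (RingHom.map_det (starRingEnd ℂ) J).symm
  rw [this]
  exact hJ.map _

theorem slotMat_gram (J G : Matrix (Fin n) (Fin n) ℂ) (hJ : IsUnit J.det) (k : Slot) :
    (slotMat J k).transpose * k.gram (J.transpose * G * J.map (starRingEnd ℂ)) *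
      (slotMat J k).map (starRingEnd ℂ) = k.gram G := by
  have hJt : IsUnit J.transpose.det := by rwa [Matrix.det_transpose]
  have hJc := isUnit_det_map_conj hJ
  have hJct : IsUnit (J.map (starRingEnd ℂ)).transpose.det := by rwa [Matrix.det_transpose]
  have hcc : ∀ A : Matrix (Fin n) (Fin n) ℂ,
      (A.map (starRingEnd ℂ)).map (starRingEnd ℂ) = A := by
    intro A; ext; simp
  cases k
  · simp only [slotMat, Slot.gram, Matrix.transpose_nonsing_inv, ← map_conj_inv J hJ]
    simp only [Matrix.mul_assoc, Matrix.mul_nonsing_inv _ hJc, Matrix.mul_one]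
    rw [← Matrix.mul_assoc, Matrix.nonsing_inv_mul _ hJt, Matrix.one_mul]
  · simp only [slotMat, Slot.gram, Matrix.transpose_transpose, Matrix.mul_inv_rev,
      Matrix.transpose_mul, Matrix.transpose_nonsing_inv, Matrix.transpose_map]
    rw [Matrix.mul_assoc, Matrix.mul_assoc, Matrix.mul_assoc, Matrix.nonsing_inv_mul _ hJct,
      Matrix.mul_one, ← Matrix.mul_assoc, Matrix.mul_nonsing_inv _ hJ, Matrix.one_mul]
  · have hc : J⁻¹.map (starRingEnd ℂ) = (J.map (starRingEnd ℂ))⁻¹ := (map_conj_inv J hJ).symm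
    simp only [slotMat, Slot.gram, Matrix.transpose_mul, Matrix.transpose_transpose, hcc]
    rw [hc, Matrix.transpose_nonsing_inv]
    rw [Matrix.mul_assoc, Matrix.mul_assoc, Matrix.mul_assoc, Matrix.mul_nonsing_inv _ hJ,
      Matrix.mul_one, ← Matrix.mul_assoc, Matrix.nonsing_inv_mul _ hJct, Matrix.one_mul]
  · simp only [slotMat, Slot.gram, Matrix.transpose_transpose, Matrix.mul_inv_rev, hcc,
      ← Matrix.transpose_map]
    rw [Matrix.mul_assoc, Matrix.mul_assoc, Matrix.mul_assoc, Matrix.nonsing_inv_mul _ hJt,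
      Matrix.mul_one, ← Matrix.mul_assoc, Matrix.mul_nonsing_inv _ hJc, Matrix.one_mul]

theorem sum_sum_prod_mul_prod_mul_prod (P Q R : Fin m → Matrix (Fin n) (Fin n) ℂ)
    (K L : Fin m → Fin n) :
    ∑ I : Fin m → Fin n, ∑ I' : Fin m → Fin n,
      (∏ s, Q s (I s) (I' s)) * (∏ s, P s (I s) (K s)) * (∏ s, R s (I' s) (L s)) =
    ∏ s, ((P s).transpose * Q s * R s) (K s) (L s) := by
  have h : ∀ s, ((P s).transpose * Q s * R s) (K s) (L s) =
      ∑ i, ∑ i', Q s i i' * P s i (K s) * R s i' (L s) := by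
    intro s
    rw [Matrix.mul_apply, Finset.sum_comm]
    refine Finset.sum_congr rfl fun i' _ => ?_
    rw [Matrix.mul_apply, Finset.sum_mul]
    exact Finset.sum_congr rfl fun i _ => by rw [Matrix.transpose_apply]; ring
  simp_rw [h, Finset.prod_univ_sum, Fintype.piFinset_univ, Finset.prod_mul_distrib]

theorem sum_four_comm {α : Type*} [Fintype α] (f : α → α → α → α → ℂ) :
    ∑ a, ∑ b, ∑ c, ∑ d, f a b c d = ∑ c, ∑ d, ∑ a, ∑ b, f a b c d := by
  calc _ = ∑ x : α × α, ∑ y : α × α, f x.1 x.2 y.1 y.2 := by simp only [Fintype.sum_prod_type]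
    _ = ∑ y : α × α, ∑ x : α × α, f x.1 x.2 y.1 y.2 := Finset.sum_comm
    _ = _ := by simp only [Fintype.sum_prod_type]

/-- The norm of a tensor does not depend on the coordinates. -/
theorem tensorNorm_slotTransform (J G : Matrix (Fin n) (Fin n) ℂ) (hJ : IsUnit J.det)
    (κ : Fin m → Slot) (A : (Fin m → Fin n) → ℂ) :
    tensorNorm (J.transpose * G * J.map (starRingEnd ℂ)) κ (slotTransform J κ A) =
      tensorNorm G κ A := by
  unfold tensorNorm
  congr 2
  set G' := J.transpose * G * J.map (starRingEnd ℂ)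
  have h1 : ∀ K L : Fin m → Fin n, ∏ s, (κ s).gram G (K s) (L s) =
      ∑ I : Fin m → Fin n, ∑ I' : Fin m → Fin n, (∏ s, (κ s).gram G' (I s) (I' s)) *
        (∏ s, slotMat J (κ s) (I s) (K s)) *
        (∏ s, ((slotMat J (κ s)).map (starRingEnd ℂ)) (I' s) (L s)) := by
    intro K L
    rw [sum_sum_prod_mul_prod_mul_prod (fun s => slotMat J (κ s)) (fun s => (κ s).gram G')
      (fun s => (slotMat J (κ s)).map (starRingEnd ℂ))]
    exact Finset.prod_congr rfl fun s _ => by rw [slotMat_gram J G hJ]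
  calc _ = ∑ I : Fin m → Fin n, ∑ I' : Fin m → Fin n, ∑ K : Fin m → Fin n, ∑ L : Fin m → Fin n,
        (∏ s, (κ s).gram G' (I s) (I' s)) * ((∏ s, slotMat J (κ s) (I s) (K s)) * A K) *
        (starRingEnd ℂ) ((∏ s, slotMat J (κ s) (I' s) (L s)) * A L) := by
        refine Finset.sum_congr rfl fun I _ => Finset.sum_congr rfl fun I' _ => ?_
        simp only [slotTransform, map_sum]
        rw [mul_assoc, Finset.sum_mul_sum, Finset.mul_sum]
        refine Finset.sum_congr rfl fun K _ => ?_
        rw [Finset.mul_sum]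
        exact Finset.sum_congr rfl fun L _ => by ring
    _ = ∑ K : Fin m → Fin n, ∑ L : Fin m → Fin n, ∑ I : Fin m → Fin n, ∑ I' : Fin m → Fin n,
        (∏ s, (κ s).gram G' (I s) (I' s)) * ((∏ s, slotMat J (κ s) (I s) (K s)) * A K) *
        (starRingEnd ℂ) ((∏ s, slotMat J (κ s) (I' s) (L s)) * A L) := sum_four_comm _
    _ = _ := by
        refine Finset.sum_congr rfl fun K _ => Finset.sum_congr rfl fun L _ => ?_
        rw [h1, Finset.sum_mul, Finset.sum_mul]
        refine Finset.sum_congr rfl fun I _ => ?_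
        rw [Finset.sum_mul, Finset.sum_mul]
        refine Finset.sum_congr rfl fun I' _ => ?_
        simp only [map_mul, map_prod, Matrix.map_apply]
        ring

theorem sum_update_swap (s : Fin m) (f : (Fin m → Fin n) → Fin n → ℂ) :
    ∑ K, ∑ r, f K r = ∑ K, ∑ r, f (Function.update K s r) (K s) := by
  rw [← Fintype.sum_prod_type', ← Fintype.sum_prod_type']
  refine Fintype.sum_equiv
    (Function.Involutive.toPerm (fun x : (Fin m → Fin n) × Fin n =>
      (Function.update x.1 s x.2, x.1 s)) ?_) _ _ ?_
  · rintro ⟨K, r⟩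
    simp
  · rintro ⟨K, r⟩
    simp [Function.Involutive.toPerm]

/-- The Leibniz rule for a transformed tensor, in matrix form: `P s` is the transition matrix of
the index `s`, `dP s` its derivative, and `C s`, `C' s` are the connection matrices in the old and
in the new coordinates. -/
theorem leibniz_slots (P C C' dP : Fin m → Matrix (Fin n) (Fin n) ℂ)
    (h : ∀ s, dP s = P s * C s - C' s * P s) (A : (Fin m → Fin n) → ℂ) (I : Fin m → Fin n) :
    ∑ K : Fin m → Fin n, (∑ s, (∏ b ∈ Finset.univ.erase s, P b (I b) (K b)) * dP s (I s) (K s)) *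
        A K +
      ∑ s, ∑ r, C' s (I s) r *
        ∑ K : Fin m → Fin n, (∏ b, P b (Function.update I s r b) (K b)) * A K =
    ∑ K : Fin m → Fin n, (∏ b, P b (I b) (K b)) *
      ∑ s, ∑ r, C s (K s) r * A (Function.update K s r) := by
  have e1 : ∀ (s : Fin m) (r : Fin n) (K : Fin m → Fin n),
      ∏ b, P b (Function.update I s r b) (K b) =
        P s r (K s) * ∏ b ∈ Finset.univ.erase s, P b (I b) (K b) := by
    intro s r K
    rw [← Finset.mul_prod_erase _ _ (Finset.mem_univ s), Function.update_self]
    congr 1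
    exact Finset.prod_congr rfl fun b hb => by
      rw [Function.update_of_ne (Finset.ne_of_mem_erase hb)]
  have e2 : ∀ (s : Fin m) (r : Fin n) (K : Fin m → Fin n),
      ∏ b, P b (I b) (Function.update K s r b) =
        P s (I s) r * ∏ b ∈ Finset.univ.erase s, P b (I b) (K b) := by
    intro s r K
    rw [← Finset.mul_prod_erase _ _ (Finset.mem_univ s), Function.update_self]
    congr 1
    exact Finset.prod_congr rfl fun b hb => by
      rw [Function.update_of_ne (Finset.ne_of_mem_erase hb)]
  simp_rw [e1, Finset.mul_sum, Finset.sum_mul]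
  rw [Finset.sum_comm, ← Finset.sum_add_distrib,
    Finset.sum_comm (s := Finset.univ) (t := Finset.univ)
    (f := fun K s => ∑ r, (∏ b, P b (I b) (K b)) * (C s (K s) r * A (Function.update K s r)))]
  refine Finset.sum_congr rfl fun s _ => ?_
  rw [sum_update_swap s (fun K r => (∏ b, P b (I b) (K b)) *
    (C s (K s) r * A (Function.update K s r)))]
  simp_rw [e2, Function.update_self, Function.update_idem, Function.update_eq_self]
  rw [Finset.sum_comm (s := (Finset.univ : Finset (Fin n))), ← Finset.sum_add_distrib]
  refine Finset.sum_congr rfl fun K _ => ?_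
  have h1 : dP s (I s) (K s) =
      ∑ r, P s (I s) r * C s r (K s) - ∑ r, C' s (I s) r * P s r (K s) := by
    rw [h s, Matrix.sub_apply, Matrix.mul_apply, Matrix.mul_apply]
  rw [h1, mul_sub, sub_mul, Finset.mul_sum, Finset.mul_sum, Finset.sum_mul, Finset.sum_mul,
    sub_add_eq_add_sub, add_sub_assoc, ← Finset.sum_sub_distrib]
  have h2 : ∑ r,
      (C' s (I s) r * (P s r (K s) * (∏ b ∈ Finset.univ.erase s, P b (I b) (K b)) * A K) -
      (∏ b ∈ Finset.univ.erase s, P b (I b) (K b)) * (C' s (I s) r * P s r (K s)) * A K) = 0 :=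
    Finset.sum_eq_zero fun r _ => by ring
  rw [h2, add_zero]
  exact Finset.sum_congr rfl fun r _ => by ring

end Algebra

/-! ### Covariant derivatives under a holomorphic change of coordinates -/

section SmoothMatrix

variable {𝕜 X : Type*} [RCLike 𝕜] [NormedAlgebra 𝕜 ℂ] [NormedAddCommGroup X] [NormedSpace 𝕜 X]
  {n : ℕ} {r : ℕ∞ω} {F : X → Matrix (Fin n) (Fin n) ℂ} {x : X}

theorem contDiffAt_det (hF : ∀ i j, ContDiffAt 𝕜 r (fun w => F w i j) x) :
    ContDiffAt 𝕜 r (fun w => (F w).det) x := by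
  simp_rw [Matrix.det_apply']
  exact ContDiffAt.sum fun σ _ => contDiffAt_const.mul (contDiffAt_prod fun i _ => hF _ _)

theorem contDiffAt_inv_entry (hF : ∀ i j, ContDiffAt 𝕜 r (fun w => F w i j) x)
    (hx : IsUnit (F x).det) (i j : Fin n) : ContDiffAt 𝕜 r (fun w => (F w)⁻¹ i j) x := by
  simp_rw [Matrix.inv_def, Matrix.smul_apply, smul_eq_mul, Ring.inverse_eq_inv',
    Matrix.adjugate_apply]
  refine ((contDiffAt_det hF).inv hx.ne_zero).mul (contDiffAt_det fun k l => ?_)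
  simp_rw [Matrix.updateRow_apply]
  split_ifs
  · exact contDiffAt_const
  · exact hF _ _

end SmoothMatrix

section Covariant

variable {n m : ℕ}

/-- The entrywise Wirtinger derivative `∂_p` of a matrix-valued function. -/
def wirtMat {k l : Type*} (p : Fin n) (F : (Fin n → ℂ) → Matrix k l ℂ) (z : Fin n → ℂ) :
    Matrix k l ℂ := Matrix.of fun i j => wirt p (fun w => F w i j) z

theorem wirtMat_mul {k l q : Type*} [Fintype l] {F : (Fin n → ℂ) → Matrix k l ℂ}
    {H : (Fin n → ℂ) → Matrix l q ℂ} {z : Fin n → ℂ} (p : Fin n)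
    (hF : ∀ i j, DifferentiableAt ℝ (fun w => F w i j) z)
    (hH : ∀ i j, DifferentiableAt ℝ (fun w => H w i j) z) :
    wirtMat p (fun w => F w * H w) z = wirtMat p F z * H z + F z * wirtMat p H z := by
  ext i j
  simp only [wirtMat, Matrix.of_apply, Matrix.mul_apply, Matrix.add_apply]
  rw [wirt_sum _ fun a _ => (hF i a).fun_mul (hH a j), ← Finset.sum_add_distrib]
  exact Finset.sum_congr rfl fun a _ => wirt_mul (hF i a) (hH a j)

/-- The matrix `(Γ^k_{pj})` with row index `k` and column index `j`. -/
def chMat (G : FormCoeff n) (z : Fin n → ℂ) (p : Fin n) : Matrix (Fin n) (Fin n) ℂ :=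
  Matrix.of fun k j => christoffel G z k p j

theorem chMat_eq (G : FormCoeff n) (z : Fin n → ℂ) (p : Fin n) :
    chMat G z p = (wirtMat p G z * (G z)⁻¹).transpose := by
  ext k j
  simp only [chMat, christoffel, wirtMat, Matrix.of_apply, Matrix.transpose_apply,
    Matrix.mul_apply]
  exact Finset.sum_congr rfl fun q _ => mul_comm _ _

/-- The connection matrix of `∇_p` on an index of the given kind. -/
def connMat (G : FormCoeff n) (z : Fin n → ℂ) (p : Fin n) : Slot → Matrix (Fin n) (Fin n) ℂ
  | .upper => chMat G z p
  | .lower => -(chMat G z p).transpose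
  | .upperBar => 0
  | .lowerBar => 0

theorem nabla_eq (G : FormCoeff n) (κ : Fin m → Slot) (A : TensorField n m) (z : Fin n → ℂ)
    (J : Fin (m + 1) → Fin n) :
    nabla G κ A z J = wirt (J 0) (fun w => A w (Fin.tail J)) z +
      ∑ s, ∑ r, connMat G z (J 0) (κ s) (Fin.tail J s) r *
        A z (Function.update (Fin.tail J) s r) := by
  unfold nabla
  congr 1
  refine Finset.sum_congr rfl fun s _ => ?_
  cases κ s <;> simp [connMat, chMat]

/-- The kind of the complex conjugate of an index. -/
def Slot.conj : Slot → Slot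
  | .upper => .upperBar
  | .lower => .lowerBar
  | .upperBar => .upper
  | .lowerBar => .lower

/-- `∇̄A` is the complex conjugate of `∇Ā`. -/
theorem nablaBar_eq_conj (G : FormCoeff n) (κ : Fin m → Slot) (A : TensorField n m)
    (z : Fin n → ℂ) (J : Fin (m + 1) → Fin n)
    (hA : DifferentiableAt ℝ (fun w => A w (Fin.tail J)) z) :
    nablaBar G κ A z J = (starRingEnd ℂ)
      (nabla G (fun s => (κ s).conj) (fun w I => (starRingEnd ℂ) (A w I)) z J) := by
  unfold nabla nablaBar
  rw [map_add, wirt_conj hA, Complex.conj_conj, map_sum]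
  congr 1
  refine Finset.sum_congr rfl fun s _ => ?_
  rcases hk : κ s <;> simp [Slot.conj, hk]

theorem slotMat_conj (J : Matrix (Fin n) (Fin n) ℂ) (k : Slot) :
    slotMat J k.conj = (slotMat J k).map (starRingEnd ℂ) := by
  cases k <;> ext <;> simp [slotMat, Slot.conj]

theorem slotTransform_conj (J : Matrix (Fin n) (Fin n) ℂ) (κ : Fin m → Slot)
    (A : (Fin m → Fin n) → ℂ) (I : Fin m → Fin n) :
    slotTransform J (fun s => (κ s).conj) (fun K => (starRingEnd ℂ) (A K)) I =
      (starRingEnd ℂ) (slotTransform J κ A I) := by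
  simp only [slotTransform, slotMat_conj, map_sum, map_mul, map_prod, Matrix.map_apply]

theorem sum_fin_succ_fun (f : (Fin (m + 1) → Fin n) → ℂ) :
    ∑ K, f K = ∑ a, ∑ K : Fin m → Fin n, f (Fin.cons a K) := by
  rw [← Fintype.sum_prod_type']
  exact (Fintype.sum_equiv (Fin.consEquiv fun _ => Fin n) _ _ fun x => rfl).symm

theorem contDiffAt_christoffel {G : FormCoeff n} {z : Fin n → ℂ}
    (hG : ∀ i j, ContDiffAt ℝ ∞ (fun w => G w i j) z) (hdet : IsUnit (G z).det)
    (k i j : Fin n) : ContDiffAt ℝ ∞ (fun w => christoffel G w k i j) z :=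
  ContDiffAt.sum fun q _ => (contDiffAt_inv_entry hG hdet q k).mul (contDiffAt_wirt (hG j q))

theorem contDiffAt_connMat {G : FormCoeff n} {z : Fin n → ℂ}
    (hG : ∀ i j, ContDiffAt ℝ ∞ (fun w => G w i j) z) (hdet : IsUnit (G z).det)
    (p : Fin n) (k : Slot) (i j : Fin n) : ContDiffAt ℝ ∞ (fun w => connMat G w p k i j) z := by
  cases k
  · exact contDiffAt_christoffel hG hdet i p j
  · exact (contDiffAt_christoffel hG hdet j p i).neg
  · exact contDiffAt_const
  · exact contDiffAt_const

theorem contDiffAt_nabla {G : FormCoeff n} {z : Fin n → ℂ} {κ : Fin m → Slot}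
    {A : TensorField n m} (hG : ∀ i j, ContDiffAt ℝ ∞ (fun w => G w i j) z)
    (hdet : IsUnit (G z).det) (hA : ∀ I, ContDiffAt ℝ ∞ (fun w => A w I) z)
    (J : Fin (m + 1) → Fin n) : ContDiffAt ℝ ∞ (fun w => nabla G κ A w J) z := by
  simp_rw [nabla_eq]
  exact (contDiffAt_wirt (hA _)).add (ContDiffAt.sum fun s _ => ContDiffAt.sum fun r _ =>
    (contDiffAt_connMat hG hdet _ _ _ _).mul (hA _))

theorem eventually_contDiffAt {f : (Fin n → ℂ) → ℂ} {z : Fin n → ℂ} (hf : ContDiffAt ℝ ∞ f z) :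
    ∀ᶠ w in 𝓝 z, DifferentiableAt ℝ f w :=
  ((hf.of_le (m := 1) (by simp)).eventually (by simp)).mono fun _ h =>
    h.differentiableAt (by simp)

theorem contDiffAt_nablaBar {G : FormCoeff n} {z : Fin n → ℂ} {κ : Fin m → Slot}
    {A : TensorField n m} (hG : ∀ i j, ContDiffAt ℝ ∞ (fun w => G w i j) z)
    (hdet : IsUnit (G z).det) (hA : ∀ I, ContDiffAt ℝ ∞ (fun w => A w I) z)
    (J : Fin (m + 1) → Fin n) : ContDiffAt ℝ ∞ (fun w => nablaBar G κ A w J) z := by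
  have h := contDiffAt_conj (contDiffAt_nabla (κ := fun s => (κ s).conj)
    (A := fun w I => (starRingEnd ℂ) (A w I)) hG hdet (fun I => contDiffAt_conj (hA I)) J)
  refine h.congr_of_eventuallyEq ?_
  filter_upwards [eventually_contDiffAt (hA (Fin.tail J))] with w hw
  exact nablaBar_eq_conj G κ A w J hw

/-- `G'` is the metric `G` written in the coordinates `z`, where `Φ` expresses the old coordinates
holomorphically and with invertible differential in terms of `z ∈ U`. -/
structure IsCoordChange (Φ : (Fin n → ℂ) → (Fin n → ℂ)) (U : Set (Fin n → ℂ))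
    (G G' : FormCoeff n) : Prop where
  isOpen : IsOpen U
  holo : ∀ z ∈ U, ContDiffAt ℂ ω Φ z
  isUnit_jac : ∀ z ∈ U, IsUnit (jac Φ z).det
  smooth : ∀ z ∈ U, ∀ i j, ContDiffAt ℝ ∞ (fun w => G w i j) (Φ z)
  isUnit_det : ∀ z ∈ U, IsUnit (G (Φ z)).det
  eq : ∀ z ∈ U, G' z = (jac Φ z).transpose * G (Φ z) * (jac Φ z).map (starRingEnd ℂ)

/-- `A` and `A'` are the components of one smooth tensor field in two coordinate systems. -/
structure IsCoordTensor (Φ : (Fin n → ℂ) → (Fin n → ℂ)) (U : Set (Fin n → ℂ))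
    (κ : Fin m → Slot) (A A' : TensorField n m) : Prop where
  smooth : ∀ z ∈ U, ∀ I, ContDiffAt ℝ ∞ (fun w => A w I) (Φ z)
  eq : ∀ z ∈ U, A' z = slotTransform (jac Φ z) κ (A (Φ z))

variable {Φ : (Fin n → ℂ) → (Fin n → ℂ)} {U : Set (Fin n → ℂ)} {G G' : FormCoeff n}
  {κ : Fin m → Slot} {A A' : TensorField n m}

theorem IsCoordTensor.tensorNorm_eq (h : IsCoordChange Φ U G G') (hA : IsCoordTensor Φ U κ A A')
    {z : Fin n → ℂ} (hz : z ∈ U) :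
    tensorNorm (G' z) κ (A' z) = tensorNorm (G (Φ z)) κ (A (Φ z)) := by
  rw [h.eq z hz, hA.eq z hz, tensorNorm_slotTransform _ _ (h.isUnit_jac z hz)]

namespace IsCoordChange

variable (h : IsCoordChange Φ U G G') {z : Fin n → ℂ} (hz : z ∈ U)
include h hz

theorem diff : DifferentiableAt ℂ Φ z := differentiableAt_of_omega (h.holo z hz)

theorem contDiffAt_comp {f : (Fin n → ℂ) → ℂ} (hf : ContDiffAt ℝ ∞ f (Φ z)) :
    ContDiffAt ℝ ∞ (fun w => f (Φ w)) z :=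
  hf.comp z (contDiffAt_real_of_complex (h.holo z hz))

/-- The inhomogeneous transformation law of the Christoffel symbols. -/
theorem jac_mul_chMat (p : Fin n) :
    jac Φ z * chMat G' z p = wirtMat p (jac Φ) z +
      (∑ a, jac Φ z a p • chMat G (Φ z) a) * jac Φ z := by
  have hJd : ∀ i j, DifferentiableAt ℝ (fun w => jac Φ w i j) z := fun i j =>
    differentiableAt_of_contDiffAt (contDiffAt_jac_real (h.holo z hz) i j)
  have hGd : ∀ i j, DifferentiableAt ℝ (fun w => G w i j) (Φ z) := fun i j =>
    differentiableAt_of_contDiffAt (h.smooth z hz i j)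
  have hGΦ : ∀ i j, DifferentiableAt ℝ (fun w => G (Φ w) i j) z := fun i j =>
    differentiableAt_of_contDiffAt (h.contDiffAt_comp hz (h.smooth z hz i j))
  have hJu := h.isUnit_jac z hz
  have hJc := isUnit_det_map_conj hJu
  have hJt : IsUnit (jac Φ z).transpose.det := by rwa [Matrix.det_transpose]
  have hGu := h.isUnit_det z hz
  have e1 : wirtMat p G' z = (wirtMat p (jac Φ) z).transpose * G (Φ z) *
      (jac Φ z).map (starRingEnd ℂ) + (jac Φ z).transpose *
      (∑ a, jac Φ z a p • wirtMat a G (Φ z)) * (jac Φ z).map (starRingEnd ℂ) := by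
    have hev : ∀ i j, (fun w => G' w i j) =ᶠ[𝓝 z] fun w =>
        ((jac Φ w).transpose * G (Φ w) * (jac Φ w).map (starRingEnd ℂ)) i j := by
      intro i j
      filter_upwards [h.isOpen.mem_nhds hz] with w hw
      rw [h.eq w hw]
    have e0 : wirtMat p G' z = wirtMat p (fun w =>
        ((jac Φ w).transpose * G (Φ w) * (jac Φ w).map (starRingEnd ℂ))) z := by
      ext i j; exact wirt_congr (hev i j)
    have hd1 : ∀ i j, DifferentiableAt ℝ (fun w => ((jac Φ w).transpose * G (Φ w)) i j) z := by
      intro i j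
      simp only [Matrix.mul_apply, Matrix.transpose_apply]
      exact DifferentiableAt.fun_sum fun a _ => (hJd a i).fun_mul (hGΦ a j)
    have hd2 : ∀ i j, DifferentiableAt ℝ (fun w => (jac Φ w).map (starRingEnd ℂ) i j) z :=
      fun i j => differentiableAt_conj (hJd i j)
    have hd3 : ∀ i j, DifferentiableAt ℝ (fun w => (jac Φ w).transpose i j) z :=
      fun i j => hJd j i
    rw [e0, wirtMat_mul p hd1 hd2, wirtMat_mul p hd3 hGΦ]
    have e2 : wirtMat p (fun w => (jac Φ w).map (starRingEnd ℂ)) z = 0 := by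
      ext i j; exact wirt_conj_jac (h.holo z hz) i j p
    have e3 : wirtMat p (fun w => G (Φ w)) z = ∑ a, jac Φ z a p • wirtMat a G (Φ z) := by
      ext i j
      rw [Matrix.sum_apply]
      simp only [wirtMat, Matrix.of_apply, Matrix.smul_apply, smul_eq_mul]
      rw [wirt_comp (hGd i j) (h.diff hz)]
      exact Finset.sum_congr rfl fun a _ => mul_comm _ _
    have e4 : wirtMat p (fun w => (jac Φ w).transpose) z = (wirtMat p (jac Φ) z).transpose := rfl
    rw [e2, e3, e4, Matrix.mul_zero, add_zero, Matrix.add_mul]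
  have e5 : wirtMat p G' z * (G' z)⁻¹ * (jac Φ z).transpose =
      (wirtMat p (jac Φ) z).transpose +
        (jac Φ z).transpose * ∑ a, jac Φ z a p • (wirtMat a G (Φ z) * (G (Φ z))⁻¹) := by
    have e6 : (G' z)⁻¹ * (jac Φ z).transpose =
        ((jac Φ z).map (starRingEnd ℂ))⁻¹ * (G (Φ z))⁻¹ := by
      rw [h.eq z hz, Matrix.mul_inv_rev, Matrix.mul_inv_rev, Matrix.mul_assoc, Matrix.mul_assoc,
        Matrix.nonsing_inv_mul _ hJt, Matrix.mul_one]
    have e7 : ∀ X : Matrix (Fin n) (Fin n) ℂ, X * (jac Φ z).map (starRingEnd ℂ) *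
        (((jac Φ z).map (starRingEnd ℂ))⁻¹ * (G (Φ z))⁻¹) = X * (G (Φ z))⁻¹ := by
      intro X
      rw [Matrix.mul_assoc, ← Matrix.mul_assoc (_root_.Matrix.map _ _),
        Matrix.mul_nonsing_inv _ hJc, Matrix.one_mul]
    rw [Matrix.mul_assoc, e6, e1, Matrix.add_mul, e7, e7, Matrix.mul_assoc,
      Matrix.mul_nonsing_inv _ hGu, Matrix.mul_one, Matrix.mul_assoc, Finset.sum_mul]
    simp only [Matrix.smul_mul]
  have e8 := congrArg Matrix.transpose e5
  simp only [Matrix.transpose_mul (wirtMat p G' z * (G' z)⁻¹), ← chMat_eq,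
    Matrix.transpose_transpose, Matrix.transpose_add] at e8
  rw [e8, Matrix.transpose_mul, Matrix.transpose_transpose, Matrix.transpose_sum]
  simp only [Matrix.transpose_smul, ← chMat_eq]

theorem christoffel_eq (k i j : Fin n) :
    christoffel G' z k i j = ∑ c, (jac Φ z)⁻¹ k c * (wirt i (fun w => jac Φ w c j) z +
      ∑ a, ∑ b, jac Φ z a i * jac Φ z b j * christoffel G (Φ z) c a b) := by
  have e : chMat G' z i = (jac Φ z)⁻¹ * (wirtMat i (jac Φ) z +
      (∑ a, jac Φ z a i • chMat G (Φ z) a) * jac Φ z) := by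
    rw [← h.jac_mul_chMat hz, ← Matrix.mul_assoc,
      Matrix.nonsing_inv_mul _ (h.isUnit_jac z hz), Matrix.one_mul]
  have e' : christoffel G' z k i j = chMat G' z i k j := rfl
  rw [e', e, Matrix.mul_apply]
  refine Finset.sum_congr rfl fun c _ => ?_
  rw [Matrix.add_apply, Finset.sum_mul, Matrix.sum_apply]
  congr 2
  refine Finset.sum_congr rfl fun a _ => ?_
  rw [Matrix.mul_apply]
  exact Finset.sum_congr rfl fun b _ => by
    simp only [Matrix.smul_apply, smul_eq_mul, chMat, Matrix.of_apply]; ring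

theorem contDiffAt_slotMat_jac (k : Slot) (i j : Fin n) :
    ContDiffAt ℝ ∞ (fun w => slotMat (jac Φ w) k i j) z := by
  have hJ := fun i j => contDiffAt_jac_real (h.holo z hz) i j
  have hJi := contDiffAt_inv_entry hJ (h.isUnit_jac z hz)
  cases k
  · exact hJi i j
  · exact hJ j i
  · exact contDiffAt_conj (hJi i j)
  · exact contDiffAt_conj (hJ j i)

theorem wirtBar_inv_jac (p i j : Fin n) : wirtBar p (fun w => (jac Φ w)⁻¹ i j) z = 0 :=
  wirtBar_of_holomorphic (differentiableAt_of_omega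
    (contDiffAt_inv_entry (contDiffAt_jac (h.holo z hz)) (h.isUnit_jac z hz) i j))

/-- The derivative of the transition matrix of an index is the difference of the connection
matrices in the two coordinate systems. -/
theorem wirtMat_slotMat (p : Fin n) (k : Slot) :
    wirtMat p (fun w => slotMat (jac Φ w) k) z =
      slotMat (jac Φ z) k * (∑ a, jac Φ z a p • connMat G (Φ z) a k) -
        connMat G' z p k * slotMat (jac Φ z) k := by
  have hJu := h.isUnit_jac z hz
  have key := h.jac_mul_chMat hz p
  cases k
  · have hd : ∀ i j, DifferentiableAt ℝ (fun w => (jac Φ w)⁻¹ i j) z := fun i j =>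
      differentiableAt_of_contDiffAt (h.contDiffAt_slotMat_jac hz .upper i j)
    have hJd : ∀ i j, DifferentiableAt ℝ (fun w => jac Φ w i j) z := fun i j =>
      differentiableAt_of_contDiffAt (contDiffAt_jac_real (h.holo z hz) i j)
    have e1 : wirtMat p (fun w => (jac Φ w)⁻¹) z * jac Φ z +
        (jac Φ z)⁻¹ * wirtMat p (jac Φ) z = 0 := by
      rw [← wirtMat_mul p hd hJd]
      ext i j
      have : (fun w => ((jac Φ w)⁻¹ * jac Φ w) i j) =ᶠ[𝓝 z]
          fun _ => (1 : Matrix (Fin n) (Fin n) ℂ) i j := by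
        filter_upwards [h.isOpen.mem_nhds hz] with w hw
        rw [Matrix.nonsing_inv_mul _ (h.isUnit_jac w hw)]
      exact (wirt_congr this).trans (wirt_const _)
    change wirtMat p (fun w => (jac Φ w)⁻¹) z = (jac Φ z)⁻¹ *
      (∑ a, jac Φ z a p • chMat G (Φ z) a) - chMat G' z p * (jac Φ z)⁻¹
    have e2 : wirtMat p (fun w => (jac Φ w)⁻¹) z =
        -((jac Φ z)⁻¹ * wirtMat p (jac Φ) z) * (jac Φ z)⁻¹ := by
      rw [← eq_neg_of_add_eq_zero_left e1, Matrix.mul_assoc, Matrix.mul_nonsing_inv _ hJu,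
        Matrix.mul_one]
    have e3 : wirtMat p (jac Φ) z = jac Φ z * chMat G' z p -
        (∑ a, jac Φ z a p • chMat G (Φ z) a) * jac Φ z := by rw [key, add_sub_cancel_right]
    rw [e2, e3, Matrix.mul_sub, ← Matrix.mul_assoc, Matrix.nonsing_inv_mul _ hJu, Matrix.one_mul,
      neg_sub, Matrix.sub_mul, Matrix.mul_assoc, Matrix.mul_assoc, Matrix.mul_nonsing_inv _ hJu,
      Matrix.mul_one]
  · change (wirtMat p (jac Φ) z).transpose = (jac Φ z).transpose *
      (∑ a, jac Φ z a p • -(chMat G (Φ z) a).transpose) -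
        -(chMat G' z p).transpose * (jac Φ z).transpose
    have e3 : wirtMat p (jac Φ) z = jac Φ z * chMat G' z p -
        (∑ a, jac Φ z a p • chMat G (Φ z) a) * jac Φ z := by rw [key, add_sub_cancel_right]
    rw [e3, Matrix.transpose_sub, Matrix.transpose_mul, Matrix.transpose_mul,
      Matrix.transpose_sum]
    simp only [Matrix.transpose_smul, smul_neg, Finset.sum_neg_distrib, Matrix.mul_neg,
      Matrix.neg_mul, sub_neg_eq_add]
    rw [sub_eq_add_neg, add_comm]
  · ext i j
    simp only [connMat, smul_zero, Finset.sum_const_zero, Matrix.mul_zero, Matrix.zero_mul,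
      sub_zero, Matrix.zero_apply]
    change wirt p (fun w => (starRingEnd ℂ) ((jac Φ w)⁻¹ i j)) z = 0
    have hd : DifferentiableAt ℝ (fun w => (jac Φ w)⁻¹ i j) z :=
      differentiableAt_of_contDiffAt (h.contDiffAt_slotMat_jac hz .upper i j)
    rw [wirt_conj hd, h.wirtBar_inv_jac hz, map_zero]
  · ext i j
    simp only [connMat, smul_zero, Finset.sum_const_zero, Matrix.mul_zero, Matrix.zero_mul,
      sub_zero, Matrix.zero_apply]
    exact wirt_conj_jac (h.holo z hz) j i p

end IsCoordChange

end Covariant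

/-! ### Torsion, curvature and their derivatives as tensors -/

section Covariant

variable {n m : ℕ} {Φ : (Fin n → ℂ) → (Fin n → ℂ)} {U : Set (Fin n → ℂ)} {G G' : FormCoeff n}
  {κ : Fin m → Slot} {A A' : TensorField n m}

theorem IsCoordTensor.conj (hA : IsCoordTensor Φ U κ A A') :
    IsCoordTensor Φ U (fun s => (κ s).conj) (fun w I => (starRingEnd ℂ) (A w I))
      (fun w I => (starRingEnd ℂ) (A' w I)) where
  smooth z hz I := contDiffAt_conj (hA.smooth z hz I)
  eq z hz := by
    ext I
    rw [slotTransform_conj, hA.eq z hz]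

theorem IsCoordTensor.contDiffAt_right (h : IsCoordChange Φ U G G')
    (hA : IsCoordTensor Φ U κ A A') {z : Fin n → ℂ} (hz : z ∈ U) (I : Fin m → Fin n) :
    ContDiffAt ℝ ∞ (fun w => A' w I) z := by
  have : (fun w => A' w I) =ᶠ[𝓝 z] fun w => slotTransform (jac Φ w) κ (A (Φ w)) I := by
    filter_upwards [h.isOpen.mem_nhds hz] with w hw
    rw [hA.eq w hw]
  refine ContDiffAt.congr_of_eventuallyEq ?_ this
  exact ContDiffAt.sum fun K _ => (contDiffAt_prod fun s _ =>
    h.contDiffAt_slotMat_jac hz _ _ _).mul (h.contDiffAt_comp hz (hA.smooth z hz K))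

theorem IsCoordTensor.nabla (h : IsCoordChange Φ U G G') (hA : IsCoordTensor Φ U κ A A') :
    IsCoordTensor Φ U (Fin.cons .lower κ : Fin (m + 1) → Slot)
      (nabla G κ A) (nabla G' κ A') where
  smooth z hz := contDiffAt_nabla (h.smooth z hz) (h.isUnit_det z hz) (hA.smooth z hz)
  eq z hz := by
    ext J
    set p := J 0
    set I := Fin.tail J
    have hP : ∀ (s : Fin m) (K : Fin m → Fin n),
        DifferentiableAt ℝ (fun w => slotMat (jac Φ w) (κ s) (I s) (K s)) z :=
      fun s K => differentiableAt_of_contDiffAt (h.contDiffAt_slotMat_jac hz _ _ _)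
    have hPP : ∀ K : Fin m → Fin n,
        DifferentiableAt ℝ (fun w => ∏ s, slotMat (jac Φ w) (κ s) (I s) (K s)) z :=
      fun K => differentiableAt_of_contDiffAt (contDiffAt_prod fun s _ =>
        h.contDiffAt_slotMat_jac hz _ _ _)
    have hAd : ∀ K, DifferentiableAt ℝ (fun w => A w K) (Φ z) := fun K =>
      differentiableAt_of_contDiffAt (hA.smooth z hz K)
    have hAΦ : ∀ K, DifferentiableAt ℝ (fun w => A (Φ w) K) z := fun K =>
      differentiableAt_of_contDiffAt (h.contDiffAt_comp hz (hA.smooth z hz K))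
    -- The coordinate derivative of `A'` by the product and the chain rule.
    have e1 : wirt p (fun w => A' w I) z =
        ∑ K : Fin m → Fin n, (∑ s, (∏ b ∈ Finset.univ.erase s,
          slotMat (jac Φ z) (κ b) (I b) (K b)) *
          wirtMat p (fun w => slotMat (jac Φ w) (κ s)) z (I s) (K s)) * A (Φ z) K +
        ∑ K : Fin m → Fin n, (∏ b, slotMat (jac Φ z) (κ b) (I b) (K b)) *
          ∑ a, jac Φ z a p * wirt a (fun w => A w K) (Φ z) := by
      have : (fun w => A' w I) =ᶠ[𝓝 z] fun w => ∑ K : Fin m → Fin n,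
          (∏ s, slotMat (jac Φ w) (κ s) (I s) (K s)) * A (Φ w) K := by
        filter_upwards [h.isOpen.mem_nhds hz] with w hw
        rw [hA.eq w hw]; rfl
      rw [wirt_congr this, wirt_sum _ fun K _ => (hPP K).fun_mul (hAΦ K),
        ← Finset.sum_add_distrib]
      refine Finset.sum_congr rfl fun K _ => ?_
      rw [wirt_mul (hPP K) (hAΦ K), wirt_finset_prod _ fun s _ => hP s K,
        wirt_comp (hAd K) (h.diff hz)]
      congr 2
      exact Finset.sum_congr rfl fun a _ => mul_comm _ _
    rw [nabla_eq, e1]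
    have e2 := leibniz_slots (fun s => slotMat (jac Φ z) (κ s))
      (fun s => ∑ a, jac Φ z a p • connMat G (Φ z) a (κ s)) (fun s => connMat G' z p (κ s))
      (fun s => wirtMat p (fun w => slotMat (jac Φ w) (κ s)) z)
      (fun s => h.wirtMat_slotMat hz p (κ s)) (A (Φ z)) I
    rw [add_right_comm, hA.eq z hz]
    simp only [slotTransform] at e2 ⊢
    rw [e2, ← Finset.sum_add_distrib, sum_fin_succ_fun, Finset.sum_comm]
    refine Finset.sum_congr rfl fun K _ => ?_
    have e3 : ∑ s, ∑ r, (∑ a, jac Φ z a p • connMat G (Φ z) a (κ s)) (K s) r *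
        A (Φ z) (Function.update K s r) = ∑ a, jac Φ z a p * ∑ s, ∑ r,
          connMat G (Φ z) a (κ s) (K s) r * A (Φ z) (Function.update K s r) := by
      simp_rw [Matrix.sum_apply, Matrix.smul_apply, smul_eq_mul, Finset.sum_mul, Finset.mul_sum]
      rw [Finset.sum_congr rfl fun s _ => Finset.sum_comm, Finset.sum_comm]
      refine Finset.sum_congr rfl fun a _ => Finset.sum_congr rfl fun s _ =>
        Finset.sum_congr rfl fun r _ => ?_
      ring
    rw [e3, ← mul_add, ← Finset.sum_add_distrib, Finset.mul_sum]
    refine Finset.sum_congr rfl fun a _ => ?_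
    rw [Fin.prod_univ_succ, nabla_eq]
    simp only [Fin.cons_zero, Fin.cons_succ, Fin.tail_cons]
    change _ = jac Φ z a p * (∏ s, slotMat (jac Φ z) (κ s) (I s) (K s)) * _
    ring

theorem IsCoordTensor.nablaBar (h : IsCoordChange Φ U G G') (hA : IsCoordTensor Φ U κ A A') :
    IsCoordTensor Φ U (Fin.cons .lowerBar κ : Fin (m + 1) → Slot)
      (nablaBar G κ A) (nablaBar G' κ A') where
  smooth z hz := contDiffAt_nablaBar (h.smooth z hz) (h.isUnit_det z hz) (hA.smooth z hz)
  eq z hz := by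
    have hc := (hA.conj.nabla h).eq z hz
    ext J
    rw [nablaBar_eq_conj G' κ A' z J (differentiableAt_of_contDiffAt (hA.contDiffAt_right h hz _)),
      hc, ← slotTransform_conj]
    congr 1
    · ext s
      refine Fin.cases ?_ (fun s => ?_) s
      · rfl
      · simp only [Fin.cons_succ]
        cases κ s <;> rfl
    · ext K
      rw [nablaBar_eq_conj G κ A _ K (differentiableAt_of_contDiffAt (hA.smooth z hz _))]

theorem sum_fin_three_fun (f : (Fin 3 → Fin n) → ℂ) :
    ∑ K, f K = ∑ a, ∑ b, ∑ c, f ![a, b, c] := by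
  simp only [sum_fin_succ_fun]
  simp only [Finset.univ_unique, Finset.sum_singleton]
  rfl

theorem sum_fin_four_fun (f : (Fin 4 → Fin n) → ℂ) :
    ∑ K, f K = ∑ a, ∑ b, ∑ c, ∑ d, f ![a, b, c, d] := by
  simp only [sum_fin_succ_fun]
  simp only [Finset.univ_unique, Finset.sum_singleton]
  rfl

/-- The torsion is a tensor: the inhomogeneous terms in the transformation law of the Christoffel
symbols are symmetric. -/
theorem isCoordTensor_torsion (h : IsCoordChange Φ U G G') :
    IsCoordTensor Φ U torsionSlots (torsion G) (torsion G') where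
  smooth z hz I :=
    (contDiffAt_christoffel (h.smooth z hz) (h.isUnit_det z hz) _ _ _).sub
      (contDiffAt_christoffel (h.smooth z hz) (h.isUnit_det z hz) _ _ _)
  eq z hz := by
    ext I
    simp only [torsion, h.christoffel_eq hz, slotTransform, sum_fin_three_fun,
      ← Finset.sum_sub_distrib]
    refine Finset.sum_congr rfl fun c _ => ?_
    rw [wirt_jac_symm (h.holo z hz) c (I 1) (I 2), ← mul_sub, add_sub_add_left_eq_sub,
      Finset.sum_comm (f := fun a b => jac Φ z a (I 2) * jac Φ z b (I 1) *
        christoffel G (Φ z) c a b), ← Finset.sum_sub_distrib, Finset.mul_sum]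
    refine Finset.sum_congr rfl fun a _ => ?_
    rw [← Finset.sum_sub_distrib, Finset.mul_sum]
    refine Finset.sum_congr rfl fun b _ => ?_
    simp [Fin.prod_univ_three, torsionSlots, slotMat]
    ring

theorem IsCoordChange.wirtBar_holo_mul {f g : (Fin n → ℂ) → ℂ} {z : Fin n → ℂ} {l : Fin n}
    (hf : ContDiffAt ℂ ω f z) (hg : DifferentiableAt ℝ g z) :
    wirtBar l (fun w => f w * g w) z = f z * wirtBar l g z := by
  rw [wirtBar_mul (differentiableAt_of_contDiffAt (contDiffAt_real_of_complex hf)) hg,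
    wirtBar_of_holomorphic (differentiableAt_of_omega hf), zero_mul, zero_add]

/-- The curvature is a tensor: the inhomogeneous terms in the transformation law of the Christoffel
symbols are holomorphic. -/
theorem isCoordTensor_chernCurvature (h : IsCoordChange Φ U G G') :
    IsCoordTensor Φ U curvatureSlots (chernCurvature G) (chernCurvature G') where
  smooth z hz I :=
    (contDiffAt_wirtBar (contDiffAt_christoffel (h.smooth z hz) (h.isUnit_det z hz) _ _ _)).neg
  eq z hz := by
    ext I
    have hch : ∀ c a b, ContDiffAt ℝ ∞ (fun w => christoffel G w c a b) (Φ z) :=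
      contDiffAt_christoffel (h.smooth z hz) (h.isUnit_det z hz)
    have hJ := contDiffAt_jac (h.holo z hz)
    have hJinv := contDiffAt_inv_entry hJ (h.isUnit_jac z hz)
    have hdJ : ∀ i c j, ContDiffAt ℂ ω (fun w => fderiv ℂ (fun w => jac Φ w c j) w
        (Pi.single i 1)) z := fun i c j =>
      ((hJ c j).fderiv_right (m := ω) (by simp)).clm_apply contDiffAt_const
    have hev : (fun w => christoffel G' w (I 3) (I 0) (I 2)) =ᶠ[𝓝 z] fun w =>
        ∑ c, (jac Φ w)⁻¹ (I 3) c *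
          (fderiv ℂ (fun w => jac Φ w c (I 2)) w (Pi.single (I 0) 1) +
          ∑ a, ∑ b, jac Φ w a (I 0) * jac Φ w b (I 2) * christoffel G (Φ w) c a b) := by
      filter_upwards [h.isOpen.mem_nhds hz] with w hw
      rw [h.christoffel_eq hw]
      refine Finset.sum_congr rfl fun c _ => ?_
      rw [wirt_of_holomorphic (differentiableAt_of_omega (contDiffAt_jac (h.holo w hw) _ _))]
    have hch' : ∀ c a b, ContDiffAt ℝ ∞ (fun w => christoffel G (Φ w) c a b) z := fun c a b =>
      h.contDiffAt_comp hz (hch c a b)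
    have hterm : ∀ c a b, ContDiffAt ℝ ∞ (fun w => jac Φ w a (I 0) * jac Φ w b (I 2) *
        christoffel G (Φ w) c a b) z := fun c a b =>
      (contDiffAt_real_of_complex ((hJ a (I 0)).mul (hJ b (I 2)))).mul (hch' c a b)
    have hterm' : ∀ c, ContDiffAt ℝ ∞ (fun w => ∑ a, ∑ b, jac Φ w a (I 0) * jac Φ w b (I 2) *
        christoffel G (Φ w) c a b) z := fun c =>
      ContDiffAt.sum fun a _ => ContDiffAt.sum fun b _ => hterm c a b
    have hin : ∀ c, ContDiffAt ℝ ∞ (fun w =>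
        fderiv ℂ (fun w => jac Φ w c (I 2)) w (Pi.single (I 0) 1) +
          ∑ a, ∑ b, jac Φ w a (I 0) * jac Φ w b (I 2) * christoffel G (Φ w) c a b) z := fun c =>
      (contDiffAt_real_of_complex (hdJ (I 0) c (I 2))).add (hterm' c)
    have e1 : wirtBar (I 1) (fun w => christoffel G' w (I 3) (I 0) (I 2)) z =
        ∑ c, (jac Φ z)⁻¹ (I 3) c * ∑ a, ∑ b, jac Φ z a (I 0) * jac Φ z b (I 2) *
          ∑ d, wirtBar d (fun w => christoffel G w c a b) (Φ z) *
            (starRingEnd ℂ) (jac Φ z d (I 1)) := by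
      rw [wirtBar_congr hev, wirtBar_sum _ fun c _ => differentiableAt_of_contDiffAt
        ((contDiffAt_real_of_complex (hJinv (I 3) c)).mul (hin c))]
      refine Finset.sum_congr rfl fun c _ => ?_
      rw [IsCoordChange.wirtBar_holo_mul (hJinv _ _) (differentiableAt_of_contDiffAt (hin c)),
        wirtBar_add (differentiableAt_of_contDiffAt (contDiffAt_real_of_complex (hdJ _ _ _)))
          (differentiableAt_of_contDiffAt (hterm' c)),
        wirtBar_of_holomorphic (differentiableAt_of_omega (hdJ _ _ _)), zero_add,
        wirtBar_sum _ fun a _ => differentiableAt_of_contDiffAt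
          (ContDiffAt.sum fun b _ => hterm c a b)]
      congr 1
      refine Finset.sum_congr rfl fun a _ => ?_
      rw [wirtBar_sum _ fun b _ => differentiableAt_of_contDiffAt (hterm c a b)]
      refine Finset.sum_congr rfl fun b _ => ?_
      rw [IsCoordChange.wirtBar_holo_mul ((hJ a (I 0)).mul (hJ b (I 2)))
        (differentiableAt_of_contDiffAt (hch' c a b)),
        wirtBar_comp (differentiableAt_of_contDiffAt (hch c a b)) (h.diff hz)]
    simp only [chernCurvature, e1, slotTransform, sum_fin_four_fun, ← Finset.sum_neg_distrib,
      Finset.mul_sum]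
    rw [Finset.sum_comm]
    refine Finset.sum_congr rfl fun a _ => ?_
    rw [Finset.sum_comm, Finset.sum_congr rfl fun b _ => Finset.sum_comm, Finset.sum_comm]
    refine Finset.sum_congr rfl fun d _ => Finset.sum_congr rfl fun b _ =>
      Finset.sum_congr rfl fun c _ => ?_
    simp [Fin.prod_univ_four, curvatureSlots, slotMat]
    ring

end Covariant

/-! ### Families depending smoothly on the collapsing parameter -/

section Regular

variable {b : ℝ} {U : Set (Fin 2 → ℂ)}

/-- The family of functions `F s`, `s ∈ [0, b]`, is jointly smooth in `(s, u)` up to and including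
the collapsed limit `s = 0`, for `u ∈ U`. -/
def IsRegular (b : ℝ) (U : Set (Fin 2 → ℂ)) (F : ℝ → (Fin 2 → ℂ) → ℂ) : Prop :=
  ∀ s ∈ Set.Icc 0 b, ∀ u ∈ U, ContDiffAt ℝ ∞ (fun p : ℝ × (Fin 2 → ℂ) => F p.1 p.2) (s, u)

namespace IsRegular

variable {F H : ℝ → (Fin 2 → ℂ) → ℂ}

theorem add (hF : IsRegular b U F) (hH : IsRegular b U H) :
    IsRegular b U fun s u => F s u + H s u :=
  fun s hs u hu => (hF s hs u hu).add (hH s hs u hu)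

theorem mul (hF : IsRegular b U F) (hH : IsRegular b U H) :
    IsRegular b U fun s u => F s u * H s u :=
  fun s hs u hu => (hF s hs u hu).mul (hH s hs u hu)

theorem conj (hF : IsRegular b U F) : IsRegular b U fun s u => (starRingEnd ℂ) (F s u) :=
  fun s hs u hu => Complex.conjCLE.contDiff.contDiffAt.comp (s, u) (hF s hs u hu)

theorem const (c : ℂ) : IsRegular b U fun _ _ => c := fun _ _ _ _ => contDiffAt_const

theorem param : IsRegular b U fun s _ => (s : ℂ) := fun s _ u _ =>
  Complex.ofRealCLM.contDiff.contDiffAt.comp (s, u) contDiffAt_fst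

theorem of_contDiffAt {f : (Fin 2 → ℂ) → ℂ} (hf : ∀ u ∈ U, ContDiffAt ℝ ∞ f u) :
    IsRegular b U fun _ u => f u := fun s _ u hu =>
  ContDiffAt.comp (s, u) (g := f) (hf u hu) contDiffAt_snd

theorem contDiffAt_right (hF : IsRegular b U F) {s : ℝ} (hs : s ∈ Set.Icc 0 b) {u : Fin 2 → ℂ}
    (hu : u ∈ U) : ContDiffAt ℝ ∞ (F s) u :=
  ContDiffAt.comp u (g := fun p : ℝ × (Fin 2 → ℂ) => F p.1 p.2) (f := fun w => (s, w))
    (hF s hs u hu) (contDiffAt_const.prodMk contDiffAt_id)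

theorem wirt (hF : IsRegular b U F) (i : Fin 2) :
    IsRegular b U fun s u => wirt i (F s) u := fun s hs u hu => by
  have h : ContDiffAt ℝ ∞ (fun p : ℝ × (Fin 2 → ℂ) => fderiv ℝ (F p.1) p.2) (s, u) := by
    refine ContDiffAt.fderiv (f := fun p : ℝ × (Fin 2 → ℂ) => F p.1) (g := Prod.snd) (n := ∞) ?_
      contDiffAt_snd (by simp)
    exact ContDiffAt.comp (f := fun q : (ℝ × (Fin 2 → ℂ)) × (Fin 2 → ℂ) => (q.1.1, q.2))
      (g := fun p : ℝ × (Fin 2 → ℂ) => F p.1 p.2) _ (hF s hs u hu) (by fun_prop)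
  exact contDiffAt_const.mul ((h.clm_apply contDiffAt_const).sub
    (contDiffAt_const.mul (h.clm_apply contDiffAt_const)))

/-- Regular families are bounded near each point, uniformly in the parameter, since the parameter
interval is compact. -/
theorem exists_bound (hF : IsRegular b U F) {u : Fin 2 → ℂ} (hu : u ∈ U) :
    ∃ C : ℝ, ∀ᶠ w in 𝓝 u, ∀ s ∈ Set.Icc 0 b, ‖F s w‖ ≤ C := by
  have hc : ContinuousOn (fun s => ‖F s u‖) (Set.Icc 0 b) := fun s hs =>
    ((ContinuousAt.comp (f := fun s : ℝ => (s, u)) (g := fun p : ℝ × (Fin 2 → ℂ) => F p.1 p.2)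
      (hF s hs u hu).continuousAt (by fun_prop)).norm).continuousWithinAt
  obtain ⟨C, hC⟩ := isCompact_Icc.bddAbove_image hc
  refine ⟨C + 1, ?_⟩
  have key : ∀ s ∈ Set.Icc 0 b, ∀ᶠ p : (Fin 2 → ℂ) × ℝ in 𝓝 u ×ˢ 𝓝 s, ‖F p.2 p.1‖ ≤ C + 1 := by
    intro s hs
    have hlt : ‖F s u‖ < C + 1 := (hC ⟨s, hs, rfl⟩).trans_lt (lt_add_one C)
    have hcont : ContinuousAt (fun p : (Fin 2 → ℂ) × ℝ => ‖F p.2 p.1‖) (u, s) :=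
      (ContinuousAt.comp (f := fun p : (Fin 2 → ℂ) × ℝ => (p.2, p.1))
        (g := fun p : ℝ × (Fin 2 → ℂ) => F p.1 p.2)
        (hF s hs u hu).continuousAt (by fun_prop)).norm
    rw [← nhds_prod_eq]
    exact (hcont.eventually (gt_mem_nhds hlt)).mono fun _ => le_of_lt
  exact isCompact_Icc.eventually_forall_of_forall_eventually fun s hs => by
    rw [nhds_prod_eq]; exact key s hs

end IsRegular

/-- The rescaling `(z, w) ↦ (z, w / s)` of the fiber coordinate, for which the fibers of the
collapsing metrics have bounded geometry. -/
def fiberScale (s : ℝ) (v : Fin 2 → ℂ) : Fin 2 → ℂ := ![v 0, (s : ℂ)⁻¹ * v 1]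

theorem contDiff_fiberScale (s : ℝ) : ContDiff ℂ ω (fiberScale s) := by
  rw [contDiff_pi]
  intro i
  fin_cases i
  · exact contDiff_apply ℂ ℂ 0
  · exact contDiff_const.mul (contDiff_apply ℂ ℂ 1)

theorem jac_fiberScale (s : ℝ) (v : Fin 2 → ℂ) :
    jac (fiberScale s) v = !![1, 0; 0, (s : ℂ)⁻¹] := by
  let L : (Fin 2 → ℂ) →L[ℂ] (Fin 2 → ℂ) := ContinuousLinearMap.pi
    ![ContinuousLinearMap.proj 0, (s : ℂ)⁻¹ • ContinuousLinearMap.proj 1]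
  have hL : fiberScale s = L := by
    ext w i
    fin_cases i <;> simp [fiberScale, L]
  ext a i
  rw [jac, hL, Matrix.of_apply, ContinuousLinearMap.fderiv]
  fin_cases a <;> fin_cases i <;> simp [L]

theorem wirt_comp_fiberScale_zero {f : (Fin 2 → ℂ) → ℂ} {s : ℝ} {v : Fin 2 → ℂ}
    (hf : DifferentiableAt ℝ f (fiberScale s v)) :
    wirt 0 (fun w => f (fiberScale s w)) v = wirt 0 f (fiberScale s v) := by
  rw [wirt_comp hf ((contDiff_fiberScale s).differentiable (by simp) v), jac_fiberScale]
  simp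

theorem wirt_comp_fiberScale_one {f : (Fin 2 → ℂ) → ℂ} {s : ℝ} {v : Fin 2 → ℂ}
    (hf : DifferentiableAt ℝ f (fiberScale s v)) :
    wirt 1 (fun w => f (fiberScale s w)) v = wirt 1 f (fiberScale s v) * (s : ℂ)⁻¹ := by
  rw [wirt_comp hf ((contDiff_fiberScale s).differentiable (by simp) v), jac_fiberScale]
  simp

/-- In the rescaled coordinates the family `f s`, `0 < s ≤ b`, is `s⁻ᵏ` times a regular family. -/
def HasOrder (b : ℝ) (U : Set (Fin 2 → ℂ)) (k : ℕ) (f : ℝ → (Fin 2 → ℂ) → ℂ) : Prop :=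
  ∃ F, IsRegular b U F ∧ ∀ s ∈ Set.Ioc 0 b, ∀ v, fiberScale s v ∈ U →
    (s : ℂ) ^ k * f s v = F s (fiberScale s v)

namespace HasOrder

variable {k l : ℕ} {f g : ℝ → (Fin 2 → ℂ) → ℂ}

theorem congr (hf : HasOrder b U k f)
    (h : ∀ s ∈ Set.Ioc 0 b, ∀ v, fiberScale s v ∈ U → g s v = f s v) : HasOrder b U k g := by
  obtain ⟨F, hF, e⟩ := hf
  exact ⟨F, hF, fun s hs v hv => by rw [h s hs v hv, e s hs v hv]⟩

theorem add (hf : HasOrder b U k f) (hg : HasOrder b U k g) :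
    HasOrder b U k fun s v => f s v + g s v := by
  obtain ⟨F, hF, e⟩ := hf
  obtain ⟨H, hH, e'⟩ := hg
  exact ⟨_, hF.add hH, fun s hs v hv => by rw [mul_add, e s hs v hv, e' s hs v hv]⟩

theorem mul (hf : HasOrder b U k f) (hg : HasOrder b U l g) :
    HasOrder b U (k + l) fun s v => f s v * g s v := by
  obtain ⟨F, hF, e⟩ := hf
  obtain ⟨H, hH, e'⟩ := hg
  exact ⟨_, hF.mul hH, fun s hs v hv => by rw [← e s hs v hv, ← e' s hs v hv]; ring⟩

theorem zero_mul (hf : HasOrder b U 0 f) (hg : HasOrder b U k g) :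
    HasOrder b U k fun s v => f s v * g s v := by
  simpa using hf.mul hg

theorem const (c : ℂ) : HasOrder b U 0 fun _ _ => c :=
  ⟨_, IsRegular.const c, fun s _ v _ => by simp⟩

theorem of_zero (k : ℕ) : HasOrder b U k fun _ _ => 0 :=
  ⟨_, IsRegular.const 0, fun s _ v _ => by simp⟩

theorem neg (hf : HasOrder b U k f) : HasOrder b U k fun s v => -f s v :=
  ((const (-1)).zero_mul hf).congr fun s _ v _ => by ring

theorem sub (hf : HasOrder b U k f) (hg : HasOrder b U k g) :
    HasOrder b U k fun s v => f s v - g s v :=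
  (hf.add hg.neg).congr fun s _ v _ => by ring

theorem sum {ι : Type*} (t : Finset ι) {f : ι → ℝ → (Fin 2 → ℂ) → ℂ}
    (hf : ∀ a ∈ t, HasOrder b U k (f a)) : HasOrder b U k fun s v => ∑ a ∈ t, f a s v := by
  classical
  induction t using Finset.induction_on with
  | empty => simpa using of_zero k
  | insert a t ha ih =>
    simp_rw [Finset.sum_insert ha]
    exact (hf a (Finset.mem_insert_self a t)).add
      (ih fun c hc => hf c (Finset.mem_insert_of_mem hc))

theorem prod {ι : Type*} (t : Finset ι) {f : ι → ℝ → (Fin 2 → ℂ) → ℂ}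
    (hf : ∀ a ∈ t, HasOrder b U 0 (f a)) : HasOrder b U 0 fun s v => ∏ a ∈ t, f a s v := by
  classical
  induction t using Finset.induction_on with
  | empty => simpa using const 1
  | insert a t ha ih =>
    simp_rw [Finset.prod_insert ha]
    exact (hf a (Finset.mem_insert_self a t)).zero_mul
      (ih fun c hc => hf c (Finset.mem_insert_of_mem hc))

theorem conj (hf : HasOrder b U k f) : HasOrder b U k fun s v => (starRingEnd ℂ) (f s v) := by
  obtain ⟨F, hF, e⟩ := hf
  exact ⟨_, hF.conj, fun s hs v hv => by rw [← e s hs v hv]; simp⟩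

theorem succ (hf : HasOrder b U k f) : HasOrder b U (k + 1) f := by
  obtain ⟨F, hF, e⟩ := hf
  exact ⟨_, IsRegular.param.mul hF, fun s hs v hv => by rw [← e s hs v hv]; ring⟩

theorem eventuallyEq (hU : IsOpen U) {F : ℝ → (Fin 2 → ℂ) → ℂ} {s : ℝ} (hs : s ∈ Set.Ioc 0 b)
    (e : ∀ s ∈ Set.Ioc 0 b, ∀ v, fiberScale s v ∈ U → (s : ℂ) ^ k * f s v = F s (fiberScale s v))
    {v : Fin 2 → ℂ} (hv : fiberScale s v ∈ U) :
    f s =ᶠ[𝓝 v] fun w => ((s : ℂ) ^ k)⁻¹ * F s (fiberScale s w) := by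
  have hs0 : (s : ℂ) ≠ 0 := Complex.ofReal_ne_zero.2 hs.1.ne'
  filter_upwards [(contDiff_fiberScale s).continuous.continuousAt.preimage_mem_nhds
    (hU.mem_nhds hv)] with w hw
  rw [← e s hs w hw, inv_mul_cancel_left₀ (pow_ne_zero k hs0)]

theorem contDiffAt_comp_fiberScale {F : ℝ → (Fin 2 → ℂ) → ℂ} (hF : IsRegular b U F) {s : ℝ}
    (hs : s ∈ Set.Ioc 0 b) {v : Fin 2 → ℂ} (hv : fiberScale s v ∈ U) :
    ContDiffAt ℝ ∞ (fun w => F s (fiberScale s w)) v :=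
  (hF.contDiffAt_right ⟨hs.1.le, hs.2⟩ hv).comp v
    (contDiffAt_real_of_complex (contDiff_fiberScale s).contDiffAt)

theorem contDiffAt (hU : IsOpen U) (hf : HasOrder b U k f) {s : ℝ} (hs : s ∈ Set.Ioc 0 b)
    {v : Fin 2 → ℂ} (hv : fiberScale s v ∈ U) : ContDiffAt ℝ ∞ (f s) v := by
  obtain ⟨F, hF, e⟩ := hf
  exact (contDiffAt_const.mul (contDiffAt_comp_fiberScale hF hs hv)).congr_of_eventuallyEq
    (eventuallyEq hU hs e hv)

/-- A derivative in the rescaled coordinates costs at most one factor `s⁻¹`. -/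
theorem wirt (hU : IsOpen U) (hf : HasOrder b U k f) (i : Fin 2) :
    HasOrder b U (k + 1) fun s v => wirt i (f s) v := by
  obtain ⟨F, hF, e⟩ := hf
  have key : ∀ s ∈ Set.Ioc 0 b, ∀ v, fiberScale s v ∈ U →
      CollapsingSurfaces.wirt i (f s) v =
        ((s : ℂ) ^ k)⁻¹ * CollapsingSurfaces.wirt i (fun w => F s (fiberScale s w)) v :=
    fun s hs v hv => by
      rw [wirt_congr (eventuallyEq hU hs e hv), wirt_const_mul _
        (differentiableAt_of_contDiffAt (contDiffAt_comp_fiberScale hF hs hv))]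
  have hd : ∀ s ∈ Set.Ioc 0 b, ∀ v, fiberScale s v ∈ U →
      DifferentiableAt ℝ (F s) (fiberScale s v) := fun s hs v hv =>
    differentiableAt_of_contDiffAt (hF.contDiffAt_right ⟨hs.1.le, hs.2⟩ hv)
  have hs0 : ∀ s ∈ Set.Ioc 0 b, (s : ℂ) ≠ 0 := fun s hs => Complex.ofReal_ne_zero.2 hs.1.ne'
  fin_cases i
  · refine ⟨_, IsRegular.param.mul (hF.wirt 0), fun s hs v hv => ?_⟩
    have := hs0 s hs
    refine (congrArg _ (key s hs v hv)).trans ?_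
    simp only [Fin.zero_eta, wirt_comp_fiberScale_zero (hd s hs v hv)]
    field_simp
    ring
  · refine ⟨_, hF.wirt 1, fun s hs v hv => ?_⟩
    have := hs0 s hs
    refine (congrArg _ (key s hs v hv)).trans ?_
    simp only [Fin.mk_one, wirt_comp_fiberScale_one (hd s hs v hv)]
    field_simp
    ring

/-- No factor `s⁻¹` is lost by differentiating a family whose fiber derivative is divisible
by `s`. -/
theorem wirt_of_dvd {F B : ℝ → (Fin 2 → ℂ) → ℂ} (hF : IsRegular b U F)
    (hB : IsRegular b U B)
    (h : ∀ s ∈ Set.Ioc 0 b, ∀ u ∈ U, CollapsingSurfaces.wirt 1 (F s) u = s * B s u) (i : Fin 2) :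
    HasOrder b U 0 fun s v =>
      CollapsingSurfaces.wirt i (fun w => F s (fiberScale s w)) v := by
  have hd : ∀ s ∈ Set.Ioc 0 b, ∀ v, fiberScale s v ∈ U →
      DifferentiableAt ℝ (F s) (fiberScale s v) := fun s hs v hv =>
    differentiableAt_of_contDiffAt (hF.contDiffAt_right ⟨hs.1.le, hs.2⟩ hv)
  fin_cases i
  · exact ⟨_, hF.wirt 0, fun s hs v hv => by
      simp [wirt_comp_fiberScale_zero (hd s hs v hv)]⟩
  · refine ⟨_, hB, fun s hs v hv => ?_⟩
    have hs0 : (s : ℂ) ≠ 0 := Complex.ofReal_ne_zero.2 hs.1.ne'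
    simp only [Fin.mk_one, wirt_comp_fiberScale_one (hd s hs v hv), h s hs _ hv]
    field_simp

end HasOrder

/-- The coefficients, in the coordinates `(z, s w)`, of the form `s² h + (1 - s²) σ dz dz̄`; here
they are functions of the unscaled coordinates `(z, w)`, defined up to `s = 0`. -/
def scaledForm (h : FormCoeff 2) (σ : (Fin 2 → ℂ) → ℂ) (s : ℝ) : FormCoeff 2 := fun u =>
  !![(s : ℂ) ^ 2 * h u 0 0 + (1 - (s : ℂ) ^ 2) * σ u, s * h u 0 1; s * h u 1 0, h u 1 1]

/-- A metric `h` on the total space and a metric `σ dz dz̄` on the base, in coordinates `(z, w)`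
adapted to the fibration: `σ` and the restriction of `h` to the fibers do not depend on the fiber
coordinate `w`, and the rescaled metrics remain nondegenerate in the collapsed limit. -/
structure IsCollapsing (b : ℝ) (U : Set (Fin 2 → ℂ)) (h : FormCoeff 2)
    (σ : (Fin 2 → ℂ) → ℂ) : Prop where
  isOpen : IsOpen U
  smooth : ∀ u ∈ U, ∀ i j, ContDiffAt ℝ ∞ (fun w => h w i j) u
  smooth_base : ∀ u ∈ U, ContDiffAt ℝ ∞ σ u
  wirt_base : ∀ u ∈ U, wirt 1 σ u = 0
  wirt_fiber : ∀ u ∈ U, wirt 1 (fun w => h w 1 1) u = 0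
  isUnit_det : ∀ s ∈ Set.Icc 0 b, ∀ u ∈ U, IsUnit (scaledForm h σ s u).det

namespace IsCollapsing

variable {h : FormCoeff 2} {σ : (Fin 2 → ℂ) → ℂ} (H : IsCollapsing b U h σ)
include H

theorem isRegular_scaledForm (i j : Fin 2) :
    IsRegular b U fun s u => scaledForm h σ s u i j := by
  have hh := fun i j => IsRegular.of_contDiffAt (b := b) fun u hu => H.smooth u hu i j
  have hs : IsRegular b U fun s _ => (s : ℂ) ^ 2 := by
    simpa only [sq] using IsRegular.param.mul IsRegular.param
  have h1 : IsRegular b U fun s _ => 1 - (s : ℂ) ^ 2 := by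
    simpa only [neg_one_mul, ← sub_eq_add_neg] using
      (IsRegular.const 1).add ((IsRegular.const (-1)).mul hs)
  fin_cases i <;> fin_cases j
  · exact (hs.mul (hh 0 0)).add (h1.mul (IsRegular.of_contDiffAt H.smooth_base))
  · exact IsRegular.param.mul (hh 0 1)
  · exact IsRegular.param.mul (hh 1 0)
  · exact hh 1 1

theorem hasOrder_form (i j : Fin 2) :
    HasOrder b U 0 fun s v => scaledForm h σ s (fiberScale s v) i j :=
  ⟨_, H.isRegular_scaledForm i j, fun s _ v _ => by simp⟩

theorem hasOrder_inv (i j : Fin 2) :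
    HasOrder b U 0 fun s v => (scaledForm h σ s (fiberScale s v))⁻¹ i j :=
  ⟨fun s u => (scaledForm h σ s u)⁻¹ i j, fun s hs u hu =>
    contDiffAt_inv_entry (F := fun p : ℝ × (Fin 2 → ℂ) => scaledForm h σ p.1 p.2)
      (fun i j => H.isRegular_scaledForm i j s hs u hu) (H.isUnit_det s hs u hu) i j,
    fun s _ v _ => by simp⟩

/-- The fiber derivatives of the metric coefficients do not blow up: this is where flatness of the
fibers enters. -/
theorem hasOrder_wirt_form (p i j : Fin 2) :
    HasOrder b U 0 fun s v => wirt p (fun w => scaledForm h σ s (fiberScale s w) i j) v := by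
  have hh := fun i j => IsRegular.of_contDiffAt (b := b) fun u hu => H.smooth u hu i j
  have hd : ∀ u ∈ U, ∀ i j, DifferentiableAt ℝ (fun w => h w i j) u := fun u hu i j =>
    differentiableAt_of_contDiffAt (H.smooth u hu i j)
  have key : ∃ B, IsRegular b U B ∧ ∀ s ∈ Set.Ioc 0 b, ∀ u ∈ U,
      wirt 1 (fun w => scaledForm h σ s w i j) u = s * B s u := by
    fin_cases i <;> fin_cases j
    · refine ⟨_, IsRegular.param.mul ((hh 0 0).wirt 1), fun s _ u hu => ?_⟩
      have hσ := differentiableAt_of_contDiffAt (H.smooth_base u hu)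
      change wirt 1 (fun w => (s : ℂ) ^ 2 * h w 0 0 + (1 - (s : ℂ) ^ 2) * σ w) u = _
      rw [wirt_add ((hd u hu 0 0).const_mul _) (hσ.const_mul _), wirt_const_mul _ (hd u hu 0 0),
        wirt_const_mul _ hσ, H.wirt_base u hu]
      ring
    · exact ⟨_, (hh 0 1).wirt 1, fun s _ u hu => wirt_const_mul _ (hd u hu 0 1)⟩
    · exact ⟨_, (hh 1 0).wirt 1, fun s _ u hu => wirt_const_mul _ (hd u hu 1 0)⟩
    · exact ⟨_, IsRegular.const 0, fun s _ u hu => (H.wirt_fiber u hu).trans (mul_zero _).symm⟩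
  obtain ⟨B, hB, e⟩ := key
  exact HasOrder.wirt_of_dvd (H.isRegular_scaledForm i j) hB e p

theorem hasOrder_christoffel (k i j : Fin 2) :
    HasOrder b U 0 fun s v =>
      christoffel (fun w => scaledForm h σ s (fiberScale s w)) v k i j :=
  HasOrder.sum _ fun q _ => (H.hasOrder_inv q k).zero_mul (H.hasOrder_wirt_form i j q)

theorem hasOrder_connMat (p : Fin 2) (k : Slot) (i j : Fin 2) :
    HasOrder b U 0 fun s v =>
      connMat (fun w => scaledForm h σ s (fiberScale s w)) v p k i j := by
  cases k
  · exact H.hasOrder_christoffel i p j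
  · exact (H.hasOrder_christoffel j p i).neg
  · exact HasOrder.const 0
  · exact HasOrder.const 0

theorem hasOrder_gram (k : Slot) (i j : Fin 2) :
    HasOrder b U 0 fun s v => k.gram (scaledForm h σ s (fiberScale s v)) i j := by
  cases k
  · exact H.hasOrder_form i j
  · exact H.hasOrder_inv j i
  · exact H.hasOrder_form j i
  · exact H.hasOrder_inv i j

variable {m k : ℕ} {κ : Fin m → Slot} {A : ℝ → TensorField 2 m}

theorem hasOrder_nabla (hA : ∀ I, HasOrder b U k fun s v => A s v I) (J : Fin (m + 1) → Fin 2) :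
    HasOrder b U (k + 1) fun s v =>
      nabla (fun w => scaledForm h σ s (fiberScale s w)) κ (A s) v J := by
  simp_rw [nabla_eq]
  exact ((hA _).wirt H.isOpen _).add (HasOrder.sum _ fun s _ => HasOrder.sum _ fun r _ =>
    ((H.hasOrder_connMat _ _ _ _).zero_mul (hA _)).succ)

theorem hasOrder_nablaBar (hA : ∀ I, HasOrder b U k fun s v => A s v I)
    (J : Fin (m + 1) → Fin 2) :
    HasOrder b U (k + 1) fun s v =>
      nablaBar (fun w => scaledForm h σ s (fiberScale s w)) κ (A s) v J :=
  (H.hasOrder_nabla (κ := fun s => (κ s).conj) (A := fun s w I => (starRingEnd ℂ) (A s w I))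
    (fun I => (hA I).conj) J).conj.congr fun _ hs _ hv =>
      nablaBar_eq_conj _ _ _ _ _
        (differentiableAt_of_contDiffAt ((hA (Fin.tail J)).contDiffAt H.isOpen hs hv))

theorem hasOrder_torsion (I : Fin 3 → Fin 2) :
    HasOrder b U 0 fun s v => torsion (fun w => scaledForm h σ s (fiberScale s w)) v I :=
  (H.hasOrder_christoffel _ _ _).sub (H.hasOrder_christoffel _ _ _)

theorem hasOrder_chernCurvature (I : Fin 4 → Fin 2) :
    HasOrder b U 1 fun s v =>
      chernCurvature (fun w => scaledForm h σ s (fiberScale s w)) v I :=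
  ((((H.hasOrder_christoffel (I 3) (I 0) (I 2)).conj).wirt H.isOpen (I 1)).conj.neg).congr
    fun _ hs _ hv => by
      rw [wirt_conj (differentiableAt_of_contDiffAt
        ((H.hasOrder_christoffel _ _ _).contDiffAt H.isOpen hs hv)), Complex.conj_conj]
      rfl

/-- A tensor of order `k` has norm `O(s⁻ᵏ)`, locally uniformly in the unscaled coordinates. -/
theorem exists_tensorNorm_bound (hA : ∀ I, HasOrder b U k fun s v => A s v I)
    {u : Fin 2 → ℂ} (hu : u ∈ U) :
    ∃ C : ℝ, ∀ᶠ w in 𝓝 u, ∀ s ∈ Set.Ioc 0 b, ∀ v, fiberScale s v = w →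
      s ^ k * tensorNorm (scaledForm h σ s (fiberScale s v)) κ (A s v) ≤ C := by
  have hsum : HasOrder b U (k + k) fun s v => ∑ I : Fin m → Fin 2, ∑ J : Fin m → Fin 2,
      (∏ t, (κ t).gram (scaledForm h σ s (fiberScale s v)) (I t) (J t)) * A s v I *
        (starRingEnd ℂ) (A s v J) :=
    HasOrder.sum _ fun I _ => HasOrder.sum _ fun J _ =>
      ((HasOrder.prod _ fun t _ => H.hasOrder_gram _ _ _).zero_mul (hA I)).mul (hA J).conj
  obtain ⟨F, hF, e⟩ := hsum
  obtain ⟨C, hC⟩ := hF.exists_bound hu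
  refine ⟨Real.sqrt C, ?_⟩
  filter_upwards [hC, H.isOpen.mem_nhds hu] with w hw hwU s hs v hv
  have e1 := e s hs v (hv ▸ hwU)
  have hsk : 0 ≤ s ^ k := pow_nonneg hs.1.le k
  rw [tensorNorm, ← Real.sqrt_sq hsk, ← Real.sqrt_mul (sq_nonneg _)]
  refine Real.sqrt_le_sqrt ?_
  have e2 := congrArg Complex.re e1
  rw [← Complex.ofReal_pow, Complex.re_ofReal_mul] at e2
  rw [← pow_mul, mul_two, e2, hv]
  exact (Complex.re_le_norm _).trans (hw s ⟨hs.1.le, hs.2⟩)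

end IsCollapsing

end Regular

/-! ### Pull-backs under holomorphic maps -/

/-- A map factors locally through the inverse of a chart. -/
theorem eventuallyEq_symm_chart {X N : Type*} [TopologicalSpace X] [TopologicalSpace N]
    {f : X → N} {z : X}
    {n : ℕ}
    {e : OpenPartialHomeomorph N (Fin n → ℂ)} (hz : f z ∈ e.source) (hf : ContinuousAt f z) :
    f =ᶠ[𝓝 z] fun w => e.symm (e (f w)) := by
  filter_upwards [hf.preimage_mem_nhds (e.open_source.mem_nhds hz)] with w hw
  exact (e.left_inv hw).symm

section Pullback

variable {n : ℕ} {M : Type*} [TopologicalSpace M] [ChartedSpace (Fin n → ℂ) M] {k m : ℕ}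
  (h : HermitianMetric n M)

theorem HermitianMetric.form_congr {x y : M} (hxy : x = y) (v w : Fin n → ℂ) :
    h.form x v w = h.form y v w := by subst hxy; rfl

theorem HermitianMetric.pull_congr {f g : (Fin m → ℂ) → M} {z : Fin m → ℂ} (hfg : f =ᶠ[𝓝 z] g) :
    h.pull f z = h.pull g z := by
  have hm : (mfderiv 𝓘(ℂ, Fin m → ℂ) 𝓘(ℂ, Fin n → ℂ) f z : (Fin m → ℂ) →L[ℂ] (Fin n → ℂ)) =
      mfderiv 𝓘(ℂ, Fin m → ℂ) 𝓘(ℂ, Fin n → ℂ) g z := hfg.mfderiv_eq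
  ext i j
  refine (h.form_congr hfg.self_of_nhds _ _).trans ?_
  rw [hm]
  rfl

/-- Coefficients of a sesquilinear form in the frame obtained from another one by the matrix `J`. -/
theorem sesquilinear_entry {V : Type*} [AddCommGroup V] [Module ℂ V]
    (B : V →ₗ[ℂ] V →ₗ⋆[ℂ] ℂ) (e : Fin k → V) (J : Matrix (Fin k) (Fin m) ℂ) (i j : Fin m) :
    B (∑ a, J a i • e a) (∑ b, J b j • e b) =
      (J.transpose * (Matrix.of fun a b => B (e a) (e b)) * J.map (starRingEnd ℂ)) i j := by
  simp only [Matrix.mul_apply, Matrix.transpose_apply, Matrix.of_apply, Matrix.map_apply, map_sum,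
    LinearMap.sum_apply, map_smul, LinearMap.smul_apply, LinearMap.map_smulₛₗ, smul_eq_mul,
    Finset.sum_mul, Finset.mul_sum]
  exact Finset.sum_congr rfl fun b _ => Finset.sum_congr rfl fun a _ => by ring

theorem HermitianMetric.pull_comp {f : (Fin k → ℂ) → M} {Φ : (Fin m → ℂ) → (Fin k → ℂ)}
    {z : Fin m → ℂ} (hf : MDifferentiableAt 𝓘(ℂ, Fin k → ℂ) 𝓘(ℂ, Fin n → ℂ) f (Φ z))
    (hΦ : DifferentiableAt ℂ Φ z) :
    h.pull (fun w => f (Φ w)) z =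
      (jac Φ z).transpose * h.pull f (Φ z) * (jac Φ z).map (starRingEnd ℂ) := by
  have hm : ∀ i : Fin m,
      (mfderiv 𝓘(ℂ, Fin m → ℂ) 𝓘(ℂ, Fin n → ℂ) (fun w => f (Φ w)) z :
        (Fin m → ℂ) →L[ℂ] (Fin n → ℂ)) (Pi.single i 1) =
      ∑ a, jac Φ z a i • (mfderiv 𝓘(ℂ, Fin k → ℂ) 𝓘(ℂ, Fin n → ℂ) f (Φ z) :
        (Fin k → ℂ) →L[ℂ] (Fin n → ℂ)) (Pi.single a 1) := by
    intro i
    have h1 : mfderiv 𝓘(ℂ, Fin m → ℂ) 𝓘(ℂ, Fin n → ℂ) (fun w => f (Φ w)) z =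
        (mfderiv 𝓘(ℂ, Fin k → ℂ) 𝓘(ℂ, Fin n → ℂ) f (Φ z)).comp
          (mfderiv 𝓘(ℂ, Fin m → ℂ) 𝓘(ℂ, Fin k → ℂ) Φ z) :=
      mfderiv_comp z hf hΦ.mdifferentiableAt
    have h2 : (mfderiv 𝓘(ℂ, Fin m → ℂ) 𝓘(ℂ, Fin n → ℂ) (fun w => f (Φ w)) z :
        (Fin m → ℂ) →L[ℂ] (Fin n → ℂ)) (Pi.single i 1) =
        (mfderiv 𝓘(ℂ, Fin k → ℂ) 𝓘(ℂ, Fin n → ℂ) f (Φ z) :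
          (Fin k → ℂ) →L[ℂ] (Fin n → ℂ)) (fderiv ℂ Φ z (Pi.single i 1)) := by
      rw [h1, mfderiv_eq_fderiv]; rfl
    have h3 : ∀ D : (Fin k → ℂ) →L[ℂ] (Fin n → ℂ), D (fderiv ℂ Φ z (Pi.single i 1)) =
        ∑ a, jac Φ z a i • D (Pi.single a 1) := by
      intro D
      rw [fderiv_single, map_sum]
      exact Finset.sum_congr rfl fun a _ => map_smul _ _ _
    exact h2.trans (h3 _)
  ext i j
  change h.form (f (Φ z))
    ((mfderiv 𝓘(ℂ, Fin m → ℂ) 𝓘(ℂ, Fin n → ℂ) (fun w => f (Φ w)) z :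
        (Fin m → ℂ) →L[ℂ] (Fin n → ℂ)) (Pi.single i 1))
    ((mfderiv 𝓘(ℂ, Fin m → ℂ) 𝓘(ℂ, Fin n → ℂ) (fun w => f (Φ w)) z :
        (Fin m → ℂ) →L[ℂ] (Fin n → ℂ)) (Pi.single j 1)) = _
  rw [hm i, hm j]
  exact sesquilinear_entry (h.form (f (Φ z))) _ _ i j

theorem contDiffAt_ofReal {u : (Fin k → ℂ) → ℝ} {z : Fin k → ℂ} (hu : ContDiffAt ℝ ∞ u z) :
    ContDiffAt ℝ ∞ (fun w => (u w : ℂ)) z :=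
  Complex.ofRealCLM.contDiff.contDiffAt.comp z hu

theorem leviForm_congr {u v : (Fin k → ℂ) → ℝ} {z : Fin k → ℂ} (huv : u =ᶠ[𝓝 z] v) :
    leviForm u z = leviForm v z := by
  ext i j
  exact wirt_congr (wirtBar_eventuallyEq (huv.mono fun w hw => by simp only [hw]))

theorem contDiffAt_leviForm {u : (Fin k → ℂ) → ℝ} {z : Fin k → ℂ} (hu : ContDiffAt ℝ ∞ u z)
    (i j : Fin k) : ContDiffAt ℝ ∞ (fun w => leviForm u w i j) z :=
  contDiffAt_wirt (contDiffAt_wirtBar (contDiffAt_ofReal hu))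

theorem leviForm_comp {u : (Fin k → ℂ) → ℝ} {Φ : (Fin m → ℂ) → (Fin k → ℂ)} {z : Fin m → ℂ}
    (hu : ContDiffAt ℝ ∞ u (Φ z)) (hΦ : ContDiffAt ℂ ω Φ z) :
    leviForm (fun w => u (Φ w)) z =
      (jac Φ z).transpose * leviForm u (Φ z) * (jac Φ z).map (starRingEnd ℂ) := by
  have hu' := contDiffAt_ofReal hu
  have hd : ∀ a, DifferentiableAt ℝ (wirtBar a fun w => (u w : ℂ)) (Φ z) := fun a =>
    differentiableAt_of_contDiffAt (contDiffAt_wirtBar hu')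
  have hdΦ : ∀ a, DifferentiableAt ℝ (fun w => wirtBar a (fun w => (u w : ℂ)) (Φ w)) z := fun a =>
    DifferentiableAt.comp z (g := wirtBar a fun w => (u w : ℂ)) (hd a)
      ((contDiffAt_real_of_complex hΦ).differentiableAt (by simp))
  have hJ : ∀ a i, DifferentiableAt ℝ (fun w => (starRingEnd ℂ) (jac Φ w a i)) z := fun a i =>
    differentiableAt_conj (differentiableAt_of_contDiffAt (contDiffAt_jac_real hΦ a i))
  ext i j
  have hev : (wirtBar j fun w => (u (Φ w) : ℂ)) =ᶠ[𝓝 z] fun w =>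
      ∑ a, wirtBar a (fun w => (u w : ℂ)) (Φ w) * (starRingEnd ℂ) (jac Φ w a j) := by
    filter_upwards [hΦ.continuousAt.eventually (eventually_contDiffAt hu'),
      hΦ.eventually (by simp)] with w hw hw'
    exact wirtBar_comp (f := fun w => (u w : ℂ)) hw (differentiableAt_of_omega hw') j
  change wirt i (wirtBar j fun w => (u (Φ w) : ℂ)) z = _
  rw [wirt_congr hev, wirt_sum _ fun a _ => (hdΦ a).fun_mul (hJ a j), Matrix.mul_apply]
  refine Finset.sum_congr rfl fun a _ => ?_
  rw [wirt_mul (hdΦ a) (hJ a j), wirt_conj_jac hΦ, mul_zero, add_zero,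
    wirt_comp (hd a) (differentiableAt_of_omega hΦ), Matrix.mul_apply]
  congr 1
  exact Finset.sum_congr rfl fun b _ => mul_comm _ _

theorem contDiffAt_chart_comp {f : (Fin m → ℂ) → M} {z : Fin m → ℂ}
    {e : OpenPartialHomeomorph M (Fin n → ℂ)} (he : e ∈ holCharts n M) (hz : f z ∈ e.source)
    (hf : ContMDiffAt 𝓘(ℂ, Fin m → ℂ) 𝓘(ℂ, Fin n → ℂ) ω f z) :
    ContDiffAt ℂ ω (fun w => e (f w)) z :=
  contMDiffAt_iff_contDiffAt.1 ((contMDiffAt_of_mem_maximalAtlas he hz).comp z hf)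

theorem flatForm_congr {ρ : M → ℝ} {f g : (Fin m → ℂ) → M} {z : Fin m → ℂ} (hfg : f =ᶠ[𝓝 z] g) :
    flatForm h ρ f z = flatForm h ρ g z := by
  rw [flatForm, flatForm, h.pull_congr hfg, leviForm_congr (hfg.mono fun w hw => congrArg ρ hw)]

variable [IsManifold 𝓘(ℂ, Fin n → ℂ) ω M]

/-- The coefficients of the pull-back of a Hermitian metric by a holomorphic map are smooth. -/
theorem HermitianMetric.contDiffAt_pull {f : (Fin m → ℂ) → M} {z : Fin m → ℂ}
    (hf : ContMDiffAt 𝓘(ℂ, Fin m → ℂ) 𝓘(ℂ, Fin n → ℂ) ω f z) (i j : Fin m) :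
    ContDiffAt ℝ ∞ (fun w => h.pull f w i j) z := by
  set e := chartAt (Fin n → ℂ) (f z)
  have he : e ∈ holCharts n M := IsManifold.chart_mem_maximalAtlas (f z)
  have hz : f z ∈ e.source := mem_chart_source _ (f z)
  have hΦ := contDiffAt_chart_comp he hz hf
  have hev : (fun w => h.pull f w i j) =ᶠ[𝓝 z] fun w =>
      ((jac (fun w => e (f w)) w).transpose * h.pull e.symm (e (f w)) *
        (jac (fun w => e (f w)) w).map (starRingEnd ℂ)) i j := by
    filter_upwards [(eventuallyEq_symm_chart hz hf.continuousAt).eventuallyEq_nhds,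
      hf.continuousAt.preimage_mem_nhds (e.open_source.mem_nhds hz),
      hΦ.eventually (by simp)] with w h1 h2 h3
    rw [h.pull_congr h1, h.pull_comp (f := e.symm) (Φ := fun w => e (f w))
      ((contMDiffAt_symm_of_mem_maximalAtlas he (e.map_source h2)).mdifferentiableAt (by simp))
      (differentiableAt_of_omega h3)]
  refine ContDiffAt.congr_of_eventuallyEq ?_ hev
  have hP : ∀ a b, ContDiffAt ℝ ∞ (fun w => h.pull e.symm (e (f w)) a b) z := fun a b =>
    ContDiffAt.comp z (g := fun w => h.pull e.symm w a b)
      ((h.smooth e he a b).contDiffAt (e.open_target.mem_nhds (e.map_source hz)))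
      (contDiffAt_real_of_complex hΦ)
  simp only [Matrix.mul_apply, Matrix.transpose_apply, Matrix.map_apply]
  exact ContDiffAt.sum fun b _ => (ContDiffAt.sum fun a _ =>
    (contDiffAt_jac_real hΦ a i).mul (hP a b)).mul
      (contDiffAt_conj (contDiffAt_jac_real hΦ b j))

/-- Only the preferred chart at the point enters the definition of smoothness of `ρ`, and it is
holomorphic; hence `ρ` composed with a holomorphic map is smooth. -/
theorem contDiffAt_comp_of_contMDiff {ρ : M → ℝ}
    (hρ : ContMDiff 𝓘(ℝ, Fin n → ℂ) 𝓘(ℝ, ℝ) ∞ ρ) {f : (Fin m → ℂ) → M} {z : Fin m → ℂ}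
    (hf : ContMDiffAt 𝓘(ℂ, Fin m → ℂ) 𝓘(ℂ, Fin n → ℂ) ω f z) :
    ContDiffAt ℝ ∞ (fun w => ρ (f w)) z := by
  set e := chartAt (Fin n → ℂ) (f z)
  have he : e ∈ holCharts n M := IsManifold.chart_mem_maximalAtlas (f z)
  have hz : f z ∈ e.source := mem_chart_source _ (f z)
  have h1 : ContDiffAt ℝ ∞ (fun v => ρ (e.symm v)) (e (f z)) := by
    have := (contMDiffAt_iff.1 (hρ (f z))).2
    simpa [Function.comp_def, e, contDiffWithinAt_univ,
      chartAt_self_eq] using this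
  refine ContDiffAt.congr_of_eventuallyEq (f := fun w => ρ (e.symm (e (f w)))) ?_ ?_
  · exact ContDiffAt.comp z (g := fun v => ρ (e.symm v)) h1
      (contDiffAt_real_of_complex (contDiffAt_chart_comp he hz hf))
  · exact (eventuallyEq_symm_chart hz hf.continuousAt).mono fun w hw => congrArg ρ hw

variable {ρ : M → ℝ}

theorem flatForm_comp (hρ : ContMDiff 𝓘(ℝ, Fin n → ℂ) 𝓘(ℝ, ℝ) ∞ ρ) {f : (Fin k → ℂ) → M}
    {Φ : (Fin m → ℂ) → (Fin k → ℂ)} {z : Fin m → ℂ}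
    (hf : ContMDiffAt 𝓘(ℂ, Fin k → ℂ) 𝓘(ℂ, Fin n → ℂ) ω f (Φ z)) (hΦ : ContDiffAt ℂ ω Φ z) :
    flatForm h ρ (fun w => f (Φ w)) z =
      (jac Φ z).transpose * flatForm h ρ f (Φ z) * (jac Φ z).map (starRingEnd ℂ) := by
  rw [flatForm, flatForm, h.pull_comp (hf.mdifferentiableAt (by simp))
    (differentiableAt_of_omega hΦ),
    leviForm_comp (u := fun w => ρ (f w)) (contDiffAt_comp_of_contMDiff hρ hf) hΦ,
    Matrix.mul_add, Matrix.add_mul]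

theorem contDiffAt_flatForm (hρ : ContMDiff 𝓘(ℝ, Fin n → ℂ) 𝓘(ℝ, ℝ) ∞ ρ)
    {f : (Fin m → ℂ) → M} {z : Fin m → ℂ}
    (hf : ContMDiffAt 𝓘(ℂ, Fin m → ℂ) 𝓘(ℂ, Fin n → ℂ) ω f z) (i j : Fin m) :
    ContDiffAt ℝ ∞ (fun w => flatForm h ρ f w i j) z :=
  (h.contDiffAt_pull hf i j).add (contDiffAt_leviForm (contDiffAt_comp_of_contMDiff hρ hf) i j)

end Pullback

/-! ### Flat metrics on elliptic curves -/

section Flat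

theorem exists_fundamental_compact (Λ : Submodule ℤ ℂ) [DiscreteTopology Λ] [IsZLattice ℝ Λ] :
    ∃ K : Set ℂ, IsCompact K ∧ ∀ z : ℂ, ∃ l ∈ Λ, z - l ∈ K := by
  let B := (Module.Free.chooseBasis ℤ Λ).ofZLatticeBasis ℝ Λ
  have hB : Submodule.span ℤ (Set.range B) = Λ :=
    (Module.Free.chooseBasis ℤ Λ).ofZLatticeBasis_span ℝ
  refine ⟨closure (ZSpan.fundamentalDomain B),
    (ZSpan.fundamentalDomain_isBounded B).isCompact_closure, fun z => ?_⟩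
  refine ⟨ZSpan.floor B z, ?_, subset_closure (ZSpan.fract_mem_fundamentalDomain B z)⟩
  exact hB.le (ZSpan.floor B z).2

/-- A continuous function on `ℂ` that is periodic under a lattice attains its maximum. -/
theorem exists_forall_le_of_periodic (Λ : Submodule ℤ ℂ) [DiscreteTopology Λ] [IsZLattice ℝ Λ]
    {f : ℂ → ℝ} (hf : Continuous f) (hp : ∀ l ∈ Λ, ∀ z, f (z + l) = f z) :
    ∃ x, ∀ y, f y ≤ f x := by
  obtain ⟨K, hK, hcov⟩ := exists_fundamental_compact Λ
  have hne : K.Nonempty := by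
    obtain ⟨l, _, hl⟩ := hcov 0
    exact ⟨_, hl⟩
  obtain ⟨x, _, hx⟩ := hK.exists_isMaxOn hne hf.continuousOn
  refine ⟨x, fun y => ?_⟩
  obtain ⟨l, hl, hy⟩ := hcov y
  have := hp l hl (y - l)
  rw [sub_add_cancel] at this
  rw [this]
  exact hx hy

theorem differentiableAt_of_wirtBar_eq_zero {n : ℕ} {f : (Fin n → ℂ) → ℂ} {z : Fin n → ℂ}
    (hf : DifferentiableAt ℝ f z) (h : ∀ i, wirtBar i f z = 0) : DifferentiableAt ℂ f z := by
  have hL : (∑ i, wirt i f z • (ContinuousLinearMap.proj i : (Fin n → ℂ) →L[ℂ] ℂ)).restrictScalars ℝ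
      = fderiv ℝ f z := by
    ext v
    rw [fderiv_eq_sum_wirt]
    simp [h]
  exact (hasFDerivAt_of_restrictScalars ℝ hf.hasFDerivAt hL).differentiableAt

theorem jac_add_const {n : ℕ} (c z : Fin n → ℂ) : jac (fun w => w + c) z = 1 := by
  ext a i
  rw [jac, Matrix.of_apply, fderiv_add_const, fderiv_fun_id]
  simp [Matrix.one_apply, Pi.single_apply]

theorem wirt_periodic {n : ℕ} {f : (Fin n → ℂ) → ℂ} {c : Fin n → ℂ} (hp : ∀ z, f (z + c) = f z)
    (hf : ∀ z, DifferentiableAt ℝ f z) (i : Fin n) (z : Fin n → ℂ) :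
    wirt i f (z + c) = wirt i f z := by
  have h1 : wirt i (fun w => f (w + c)) z = ∑ a, wirt a f (z + c) * jac (fun w => w + c) z a i :=
    wirt_comp (Φ := fun w => w + c) (hf _) (differentiableAt_id.add_const c) i
  have h2 : (fun w => f (w + c)) = f := funext hp
  rw [h2, jac_add_const] at h1
  rw [h1, Finset.sum_eq_single i] <;> simp +contextual

/-- A flat Hermitian metric on `ℂ` that is periodic under a lattice has constant coefficient: its
Christoffel symbol is a bounded entire function, hence constant, and it vanishes where the
coefficient is maximal. -/
theorem wirt_eq_zero_of_flat (Λ : Submodule ℤ ℂ) [DiscreteTopology Λ] [IsZLattice ℝ Λ]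
    {G : FormCoeff 1} (hG : ∀ z, ContDiffAt ℝ ∞ (fun w => G w 0 0) z)
    (hpos : ∀ z, (G z).PosDef) (hcurv : ∀ z, chernCurvature G z = 0)
    (hper : ∀ l ∈ Λ, ∀ z, G (z + fun _ => l) = G z) (z : Fin 1 → ℂ) :
    wirt 0 (fun w => G w 0 0) z = 0 := by
  have hG' : ∀ z, ∀ i j, ContDiffAt ℝ ∞ (fun w => G w i j) z := by
    intro z i j
    rw [Subsingleton.elim i 0, Subsingleton.elim j 0]
    exact hG z
  have hdet : ∀ z, IsUnit (G z).det := fun z => (Matrix.isUnit_iff_isUnit_det _).1 (hpos z).isUnit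
  have hg0 : ∀ z, 0 < G z 0 0 := fun z => (hpos z).diag_pos
  have hper' : ∀ l ∈ Λ, ∀ z, (fun w => G w 0 0) (z + fun _ => l) = (fun w => G w 0 0) z :=
    fun l hl z => by simp only [hper l hl z]
  set θ : (Fin 1 → ℂ) → ℂ := fun w => christoffel G w 0 0 0 with hθ
  have hθs : ∀ z, ContDiffAt ℝ ∞ θ z := fun z => contDiffAt_christoffel (hG' z) (hdet z) 0 0 0
  have hθe : ∀ z, θ z = (G z)⁻¹ 0 0 * wirt 0 (fun w => G w 0 0) z := fun z => by
    simp [hθ, christoffel]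
  have hθp : ∀ l ∈ Λ, ∀ z, θ (z + fun _ => l) = θ z := by
    intro l hl z
    rw [hθe, hθe, hper l hl, wirt_periodic (hper' l hl)
      (fun z => differentiableAt_of_contDiffAt (hG z))]
  have hθh : ∀ z, DifferentiableAt ℂ θ z := by
    intro z
    refine differentiableAt_of_wirtBar_eq_zero (differentiableAt_of_contDiffAt (hθs z)) fun i => ?_
    have := congrFun (hcurv z) ![0, 0, 0, 0]
    rw [Subsingleton.elim i 0]
    exact neg_eq_zero.1 this
  have hcst : Differentiable ℂ fun c : ℂ => (fun _ => c : Fin 1 → ℂ) :=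
    differentiable_pi.2 fun _ => differentiable_id
  have hcont : Continuous fun c : ℂ => (fun _ => c : Fin 1 → ℂ) := hcst.continuous
  have hent : Differentiable ℂ fun c : ℂ => θ fun _ => c := fun c =>
    (hθh _).comp c (hcst c)
  obtain ⟨x, hx⟩ := exists_forall_le_of_periodic Λ (f := fun c => ‖θ fun _ => c‖)
    hent.continuous.norm (fun l hl c => by
      have := hθp l hl fun _ => c
      exact congrArg norm this)
  have hconst : ∀ c d : ℂ, θ (fun _ => c) = θ fun _ => d := by
    refine fun c d => hent.apply_eq_apply_of_bounded ?_ c d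
    refine (Metric.isBounded_closedBall (x := (0 : ℂ)) (r := ‖θ fun _ => x‖)).subset ?_
    rintro _ ⟨c, rfl⟩
    simpa using hx c
  have hgcont : Continuous fun c : ℂ => (G (fun _ => c) 0 0).re :=
    Complex.continuous_re.comp
      ((continuous_iff_continuousAt.2 fun z => (hG z).continuousAt).comp hcont)
  obtain ⟨y, hy⟩ := exists_forall_le_of_periodic Λ hgcont (fun l hl c => by
    have := hper l hl fun _ => c
    exact congrArg (fun A : Matrix (Fin 1) (Fin 1) ℂ => (A 0 0).re) this)
  have heta : ∀ z : Fin 1 → ℂ, z = fun _ => z 0 := fun z => by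
    ext i; rw [Subsingleton.elim i 0]
  -- At the maximum of the coefficient all its first derivatives vanish.
  have hmax : fderiv ℝ (fun w => G w 0 0) (fun _ => y) = 0 := by
    have hre : (fun w => G w 0 0) = fun w => (((G w 0 0).re : ℝ) : ℂ) := by
      ext w
      have := (hg0 w)
      rw [Complex.lt_def] at this
      exact Complex.ext (by simp) (by simpa using this.2.symm)
    have hmax' : IsLocalMax (fun w => (G w 0 0).re) (fun _ => y) :=
      Filter.Eventually.of_forall fun w => by
        rw [heta w]; exact hy (w 0)
    have h0 := hmax'.fderiv_eq_zero
    have hd : DifferentiableAt ℝ (fun w => (G w 0 0).re) (fun _ => y) :=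
      Complex.reCLM.differentiableAt.comp _ (differentiableAt_of_contDiffAt (hG _))
    rw [hre]
    have := (Complex.ofRealCLM.hasFDerivAt.comp _ hd.hasFDerivAt).fderiv
    rw [h0, ContinuousLinearMap.comp_zero] at this
    exact this
  have hθ0 : θ (fun _ => y) = 0 := by
    rw [hθe, wirt, hmax]
    simp
  have hz : θ z = 0 := by
    rw [heta z, hconst (z 0) y, hθ0]
  rw [hθe] at hz
  refine (mul_eq_zero.1 hz).resolve_left fun h0 => ?_
  have h1 := Matrix.mul_nonsing_inv _ (hdet z)
  have h2 := congrFun (congrFun h1 0) 0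
  rw [Matrix.mul_apply, Fin.sum_univ_one, h0, mul_zero] at h2
  simp at h2

end Flat

/-! ### Coordinates adapted to an elliptic bundle -/

section Bundle

variable {M : Type*} [TopologicalSpace M] [ChartedSpace (Fin 2 → ℂ) M]
  {S : Type*} [TopologicalSpace S] [ChartedSpace (Fin 1 → ℂ) S]
  {E : Type*} [TopologicalSpace E] [ChartedSpace ℂ E]

/-- The inclusion `ζ ↦ (z, ζ)` of a fiber. -/
def fiberIncl (z : ℂ) (ζ : Fin 1 → ℂ) : Fin 2 → ℂ := ![z, ζ 0]

/-- The projection `(z, w) ↦ z` to the base. -/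
def baseProj (v : Fin 2 → ℂ) : Fin 1 → ℂ := fun _ => v 0

theorem contDiff_fiberIncl (z : ℂ) : ContDiff ℂ ω (fiberIncl z) := by
  rw [contDiff_pi]
  intro i
  fin_cases i
  · exact contDiff_const
  · exact contDiff_apply ℂ ℂ 0

theorem contDiff_baseProj : ContDiff ℂ ω baseProj :=
  contDiff_pi.2 fun _ => contDiff_apply ℂ ℂ 0

theorem jac_fiberIncl (z : ℂ) (ζ : Fin 1 → ℂ) : jac (fiberIncl z) ζ = !![0; 1] := by
  have h : HasFDerivAt (fiberIncl z) (ContinuousLinearMap.pi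
      ![(0 : (Fin 1 → ℂ) →L[ℂ] ℂ), ContinuousLinearMap.proj 0]) ζ := by
    rw [hasFDerivAt_pi']
    intro i
    fin_cases i
    · exact hasFDerivAt_const z ζ
    · exact (ContinuousLinearMap.proj (R := ℂ) (φ := fun _ : Fin 1 => ℂ) 0).hasFDerivAt
  ext a i
  rw [jac, Matrix.of_apply, h.fderiv]
  fin_cases a <;> fin_cases i <;> simp

theorem jac_baseProj (v : Fin 2 → ℂ) : jac baseProj v = !![1, 0] := by
  have h : HasFDerivAt baseProj (ContinuousLinearMap.pi
      fun _ => (ContinuousLinearMap.proj 0 : (Fin 2 → ℂ) →L[ℂ] ℂ)) v := by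
    rw [hasFDerivAt_pi']
    intro i
    exact (ContinuousLinearMap.proj (R := ℂ) (φ := fun _ : Fin 2 => ℂ) 0).hasFDerivAt
  ext a i
  rw [jac, Matrix.of_apply, h.fderiv]
  fin_cases a; fin_cases i <;> simp

/-- A holomorphic parametrization `Ψ (z, w)` of the part of an elliptic bundle over an open piece
of a chart `c` of the base: `z` is the coordinate of the base given by `c`, and `w ∈ ℂ` is the
coordinate of the universal covering of the fiber `ℂ / Λ`. It is a local biholomorphism, but not
injective. -/
structure IsFiberParam (pr : M → S) (Λ : Submodule ℤ ℂ) (c : OpenPartialHomeomorph S (Fin 1 → ℂ))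
    (U : Set (Fin 2 → ℂ)) (Ψ : (Fin 2 → ℂ) → M) : Prop where
  isOpen : IsOpen U
  chart : c ∈ holCharts 1 S
  holo : ∀ v ∈ U, ContMDiffAt 𝓘(ℂ, Fin 2 → ℂ) 𝓘(ℂ, Fin 2 → ℂ) ω Ψ v
  mem_target : ∀ v ∈ U, baseProj v ∈ c.target
  proj : ∀ v ∈ U, pr (Ψ v) = c.symm (baseProj v)
  periodic : ∀ z, ∀ l ∈ Λ, ∀ ζ, Ψ (fiberIncl z (ζ + fun _ => l)) = Ψ (fiberIncl z ζ)
  fiber_mem : ∀ v ∈ U, ∀ ζ, fiberIncl (v 0) ζ ∈ U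
  exists_inverse : ∀ v ∈ U, ∃ Q : M → (Fin 2 → ℂ),
    ContMDiffAt 𝓘(ℂ, Fin 2 → ℂ) 𝓘(ℂ, Fin 2 → ℂ) ω Q (Ψ v) ∧ (∀ᶠ w in 𝓝 v, Q (Ψ w) = w) ∧
      ∀ᶠ x in 𝓝 (Ψ v), Ψ (Q x) = x

theorem contMDiffAt_pr [IsManifold 𝓘(ℂ, Fin 2 → ℂ) ω M] {pr : M → S}
    (hpr : IsEllipticBundle E pr) (x : M) :
    ContMDiffAt 𝓘(ℂ, Fin 2 → ℂ) 𝓘(ℂ, Fin 1 → ℂ) ω pr x := by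
  obtain ⟨φ, hφ, h1, -⟩ := hpr.2 (pr x)
  have hx : x ∈ φ.source := φ.mem_source.2 hφ
  have h2 : ContMDiffAt 𝓘(ℂ, Fin 2 → ℂ) 𝓘(ℂ, Fin 1 → ℂ) ω (fun y => (φ y).1) x :=
    contMDiffAt_fst.comp x (h1.contMDiffAt (φ.open_source.mem_nhds hx))
  refine h2.congr_of_eventuallyEq ?_
  filter_upwards [φ.open_source.mem_nhds hx] with y hy
  exact (φ.coe_fst hy).symm

/-- Every point of an elliptic bundle lies in the image of a parametrization `IsFiberParam`,
obtained from a local trivialization and the universal covering of the fiber; the lattice is the same for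
all of them. -/
theorem exists_isFiberParam [IsManifold 𝓘(ℂ, Fin 2 → ℂ) ω M]
    [IsManifold 𝓘(ℂ, Fin 1 → ℂ) ω S] [IsManifold 𝓘(ℂ, ℂ) ω E] {pr : M → S}
    (hpr : IsEllipticBundle E pr) :
    ∃ (Λ : Submodule ℤ ℂ) (_ : DiscreteTopology Λ) (_ : IsZLattice ℝ Λ), ∀ x : M,
      ∃ c U Ψ, IsFiberParam pr Λ c U Ψ ∧ ∃ v ∈ U, Ψ v = x := by
  obtain ⟨Λ, hΛd, hΛ, p, hp, hps, hpp⟩ := hpr.1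
  refine ⟨Λ, hΛd, hΛ, fun x => ?_⟩
  obtain ⟨φ, hφ, hφ1, hφ2⟩ := hpr.2 (pr x)
  set c := chartAt (Fin 1 → ℂ) (pr x) with hc
  have hch : c ∈ holCharts 1 S := IsManifold.chart_mem_maximalAtlas (pr x)
  set ψ : S × E → M := fun y => φ.toOpenPartialHomeomorph.symm y with hψ
  set Ψ : (Fin 2 → ℂ) → M := fun v => ψ (c.symm (baseProj v), p (v 1)) with hΨ
  set U : Set (Fin 2 → ℂ) := baseProj ⁻¹' (c.target ∩ c.symm ⁻¹' φ.baseSet) with hU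
  have hUo : IsOpen U :=
    (c.symm.isOpen_inter_preimage φ.open_baseSet).preimage contDiff_baseProj.continuous
  have htgt : ∀ v ∈ U, (c.symm (baseProj v), p (v 1)) ∈ φ.target := fun v hv =>
    φ.mem_target.2 hv.2
  have hsrc : ∀ v ∈ U, Ψ v ∈ φ.source := fun v hv => φ.map_target (htgt v hv)
  have hφΨ : ∀ v ∈ U, φ (Ψ v) = (c.symm (baseProj v), p (v 1)) := fun v hv =>
    φ.right_inv (htgt v hv)
  have hproj : ∀ v ∈ U, pr (Ψ v) = c.symm (baseProj v) := fun v hv => by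
    rw [← φ.coe_fst (hsrc v hv), hφΨ v hv]
  have hp' : ContMDiff 𝓘(ℂ, ℂ) 𝓘(ℂ, ℂ) ω p := hp.contMDiff
  refine ⟨c, U, Ψ, ⟨hUo, hch, ?_, fun v hv => hv.1, hproj, ?_, ?_, ?_⟩, ?_⟩
  · intro v hv
    have h1 : ContMDiffAt 𝓘(ℂ, Fin 2 → ℂ) 𝓘(ℂ, Fin 1 → ℂ) ω (fun v => c.symm (baseProj v)) v :=
      (contMDiffAt_symm_of_mem_maximalAtlas hch hv.1).comp v
        contDiff_baseProj.contDiffAt.contMDiffAt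
    have h2 : ContMDiffAt 𝓘(ℂ, Fin 2 → ℂ) 𝓘(ℂ, ℂ) ω (fun v : Fin 2 → ℂ => p (v 1)) v :=
      (hp' _).comp v (contDiff_apply ℂ ℂ (1 : Fin 2)).contDiffAt.contMDiffAt
    exact (hφ2.contMDiffAt (φ.open_target.mem_nhds (htgt v hv))).comp v (h1.prodMk h2)
  · intro z l hl ζ
    have : p ((ζ + fun _ => l : Fin 1 → ℂ) 0) = p (ζ 0) := (hpp _ _).2 (by simpa using hl)
    simp only [hΨ, fiberIncl]
    change ψ (_, p ((ζ + fun _ => l : Fin 1 → ℂ) 0)) = ψ (_, p (ζ 0))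
    rw [this]
    rfl
  · intro v hv ζ
    exact hv
  · intro v hv
    set q := (hp (v 1)).localInverse with hq
    refine ⟨fun x => ![c (pr x) 0, q (φ x).2], ?_, ?_, ?_⟩
    · have hs := hsrc v hv
      have h1 : ContMDiffAt 𝓘(ℂ, Fin 2 → ℂ) 𝓘(ℂ, Fin 1 → ℂ) ω (fun x => c (pr x)) (Ψ v) := by
        refine (contMDiffAt_of_mem_maximalAtlas hch ?_).comp _ (contMDiffAt_pr hpr _)
        rw [hproj v hv]; exact c.map_target hv.1
      have h2 : ContMDiffAt 𝓘(ℂ, Fin 2 → ℂ) 𝓘(ℂ, ℂ) ω (fun x => q (φ x).2) (Ψ v) := by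
        have h3 : ContMDiffAt 𝓘(ℂ, Fin 2 → ℂ) 𝓘(ℂ, ℂ) ω (fun x => (φ x).2) (Ψ v) :=
          contMDiffAt_snd.comp _ (hφ1.contMDiffAt (φ.open_source.mem_nhds hs))
        refine ContMDiffAt.comp _ ?_ h3
        rw [hφΨ v hv]
        exact (hp (v 1)).localInverse_contMDiffAt
      rw [contMDiffAt_pi_space]
      intro i
      fin_cases i
      · exact contMDiffAt_pi_space.1 h1 0
      · exact h2
    -- `Q x = (c (pr x), q (φ x).2)`, with `q` a local inverse of the covering, inverts `Ψ` locally.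
    · have h1 := (hp (v 1)).localInverse_eventuallyEq_left
      have h2 : ContinuousAt (fun w : Fin 2 → ℂ => w 1) v := (continuous_apply 1).continuousAt
      filter_upwards [hUo.mem_nhds hv, h2.eventually h1] with w hw hw1
      rw [hproj w hw, c.right_inv hw.1, hφΨ w hw]
      ext i
      fin_cases i
      · rfl
      · exact hw1
    · have h1 := (hp (v 1)).localInverse_eventuallyEq_right
      have h2 : ContinuousAt (fun x => (φ x).2) (Ψ v) :=
        continuousAt_snd.comp (φ.toOpenPartialHomeomorph.continuousAt (hsrc v hv))
      have h3 : ∀ᶠ x in 𝓝 (Ψ v), pr x ∈ c.source := by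
        refine (contMDiffAt_pr hpr (Ψ v)).continuousAt.eventually (c.open_source.mem_nhds ?_)
        rw [hproj v hv]; exact c.map_target hv.1
      have h4 : ∀ᶠ x in 𝓝 (Ψ v), p (q (φ x).2) = (φ x).2 := by
        have h5 : ∀ᶠ a in 𝓝 (φ (Ψ v)).2, p (q a) = a := by
          rw [hφΨ v hv]
          exact h1
        exact h2.eventually h5
      filter_upwards [h3, h4, φ.open_source.mem_nhds (hsrc v hv)] with x hx hx2 hx3
      have e1 : baseProj ![c (pr x) 0, q (φ x).2] = c (pr x) := by
        ext i; rw [Subsingleton.elim i 0]; rfl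
      change ψ (c.symm (baseProj ![c (pr x) 0, q (φ x).2]), p (q (φ x).2)) = x
      rw [e1, c.left_inv hx, hx2, ← φ.coe_fst hx3]
      exact φ.left_inv hx3
  · obtain ⟨w, hw⟩ := hps (φ x).2
    have hxs : x ∈ φ.source := φ.mem_source.2 hφ
    have e1 : baseProj ![c (pr x) 0, w] = c (pr x) := by
      ext i; rw [Subsingleton.elim i 0]; rfl
    have hcx : pr x ∈ c.source := mem_chart_source _ _
    refine ⟨![c (pr x) 0, w], ⟨?_, ?_⟩, ?_⟩
    · rw [e1]; exact c.map_source hcx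
    · change c.symm (baseProj ![c (pr x) 0, w]) ∈ φ.baseSet
      rw [e1, c.left_inv hcx]
      exact hφ
    · change ψ (c.symm (baseProj ![c (pr x) 0, w]), p w) = x
      rw [e1, c.left_inv hcx, hw, ← φ.coe_fst hxs]
      exact φ.left_inv hxs

end Bundle

/-! ### The reference metrics in adapted coordinates -/

section Reference

theorem mfderiv_injective_of_leftInverse {n k l : ℕ} {M : Type*} [TopologicalSpace M]
    [ChartedSpace (Fin n → ℂ) M] {f : (Fin k → ℂ) → M} {Q : M → (Fin l → ℂ)}
    {g : (Fin k → ℂ) → (Fin l → ℂ)} {z : Fin k → ℂ}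
    (hf : MDifferentiableAt 𝓘(ℂ, Fin k → ℂ) 𝓘(ℂ, Fin n → ℂ) f z)
    (hQ : MDifferentiableAt 𝓘(ℂ, Fin n → ℂ) 𝓘(ℂ, Fin l → ℂ) Q (f z))
    (h : (fun w => Q (f w)) =ᶠ[𝓝 z] g) (hg : Function.Injective (fderiv ℂ g z)) :
    Function.Injective (mfderiv 𝓘(ℂ, Fin k → ℂ) 𝓘(ℂ, Fin n → ℂ) f z) := by
  have h1 : mfderiv 𝓘(ℂ, Fin k → ℂ) 𝓘(ℂ, Fin l → ℂ) (fun w => Q (f w)) z =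
      (mfderiv 𝓘(ℂ, Fin n → ℂ) 𝓘(ℂ, Fin l → ℂ) Q (f z)).comp
        (mfderiv 𝓘(ℂ, Fin k → ℂ) 𝓘(ℂ, Fin n → ℂ) f z) := mfderiv_comp z hQ hf
  have h2 : fderiv ℂ g z = fderiv ℂ (fun w => Q (f w)) z := h.fderiv_eq.symm
  rw [mfderiv_eq_fderiv] at h1
  intro a b hab
  apply hg
  rw [h2]
  have h3 := congrArg (fun L : (Fin k → ℂ) →L[ℂ] (Fin l → ℂ) => L a) h1
  have h4 := congrArg (fun L : (Fin k → ℂ) →L[ℂ] (Fin l → ℂ) => L b) h1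
  refine h3.trans (Eq.trans ?_ h4.symm)
  exact congrArg (mfderiv 𝓘(ℂ, Fin n → ℂ) 𝓘(ℂ, Fin l → ℂ) Q (f z)) hab

/-- The coefficient of a Hermitian metric of a Riemann surface in a holomorphic chart is
positive. -/
theorem pull_symm_pos {S : Type*} [TopologicalSpace S] [ChartedSpace (Fin 1 → ℂ) S]
    (gS : HermitianMetric 1 S) {c : OpenPartialHomeomorph S (Fin 1 → ℂ)} (hc : c ∈ holCharts 1 S)
    {z : Fin 1 → ℂ} (hz : z ∈ c.target) : 0 < (gS.pull c.symm z 0 0).re := by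
  refine gS.pos _ _ ?_
  have hinj := mfderiv_injective_of_leftInverse (f := c.symm) (Q := c) (g := fun w => w) (z := z)
    ((contMDiffAt_symm_of_mem_maximalAtlas hc hz).mdifferentiableAt (by simp))
    ((contMDiffAt_of_mem_maximalAtlas hc (c.map_target hz)).mdifferentiableAt (by simp))
    ((c.open_target.eventually_mem hz).mono fun w hw => c.right_inv hw)
    (by rw [fderiv_fun_id]; exact Function.injective_id)
  intro h0
  have h1 : (Pi.single 0 1 : Fin 1 → ℂ) = 0 := hinj (h0.trans (map_zero _).symm)
  simpa using congrFun h1 0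

variable {M : Type*} [TopologicalSpace M] [ChartedSpace (Fin 2 → ℂ) M]
  {S : Type*} [TopologicalSpace S] [ChartedSpace (Fin 1 → ℂ) S]
  {pr : M → S} {Λ : Submodule ℤ ℂ} {c : OpenPartialHomeomorph S (Fin 1 → ℂ)}
  {U : Set (Fin 2 → ℂ)} {Ψ : (Fin 2 → ℂ) → M} {g₀ : HermitianMetric 2 M} {ρ : M → ℝ}
  {gS : HermitianMetric 1 S}

theorem flatForm_fiberIncl [IsManifold 𝓘(ℂ, Fin 2 → ℂ) ω M]
    (hρ : ContMDiff 𝓘(ℝ, Fin 2 → ℂ) 𝓘(ℝ, ℝ) ∞ ρ) {z : ℂ}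
    {ζ : Fin 1 → ℂ} (hΨ : ContMDiffAt 𝓘(ℂ, Fin 2 → ℂ) 𝓘(ℂ, Fin 2 → ℂ) ω Ψ (fiberIncl z ζ)) :
    flatForm g₀ ρ (fun w => Ψ (fiberIncl z w)) ζ 0 0 = flatForm g₀ ρ Ψ (fiberIncl z ζ) 1 1 := by
  rw [flatForm_comp g₀ hρ hΨ (contDiff_fiberIncl z).contDiffAt, jac_fiberIncl]
  simp [Matrix.mul_apply, Fin.sum_univ_two]

theorem fiberIncl_self (v : Fin 2 → ℂ) : fiberIncl (v 0) (fun _ => v 1) = v := by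
  ext i; fin_cases i <;> rfl

namespace IsFiberParam

variable (P : IsFiberParam pr Λ c U Ψ)
include P

/-- The flatness hypothesis applied to a whole fiber, parametrized by its universal covering. -/
theorem flat_on_fiber (hflat : IsFlatOnFibers pr g₀ ρ) {v : Fin 2 → ℂ} (hv : v ∈ U)
    (ζ : Fin 1 → ℂ) :
    (flatForm g₀ ρ (fun w => Ψ (fiberIncl (v 0) w)) ζ).PosDef ∧
      chernCurvature (flatForm g₀ ρ fun w => Ψ (fiberIncl (v 0) w)) ζ = 0 := by
  have hholo : ∀ ζ, ContMDiffAt 𝓘(ℂ, Fin 1 → ℂ) 𝓘(ℂ, Fin 2 → ℂ) ω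
      (fun w => Ψ (fiberIncl (v 0) w)) ζ := fun ζ =>
    (P.holo _ (P.fiber_mem v hv ζ)).comp ζ (contDiff_fiberIncl (v 0)).contDiffAt.contMDiffAt
  refine hflat (c.symm (baseProj v)) Set.univ _ isOpen_univ
    (fun ζ _ => (hholo ζ).contMDiffWithinAt) (fun ζ _ => ⟨P.proj _ (P.fiber_mem v hv ζ), ?_⟩) ζ
    trivial
  obtain ⟨Q, hQ, hQΨ, -⟩ := P.exists_inverse _ (P.fiber_mem v hv ζ)
  refine mfderiv_injective_of_leftInverse (Q := Q) (g := fiberIncl (v 0))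
    ((hholo ζ).mdifferentiableAt (by simp)) (hQ.mdifferentiableAt (by simp))
    ((contDiff_fiberIncl (v 0)).continuous.continuousAt.eventually hQΨ) ?_
  rw [injective_iff_map_eq_zero]
  intro a ha
  have h1 : a = a 0 • (Pi.single 0 1 : Fin 1 → ℂ) := by
    ext i; rw [Subsingleton.elim i 0]; simp
  rw [h1, map_smul, fderiv_single, jac_fiberIncl] at ha
  have h2 := congrFun ha 1
  simp at h2
  ext i
  rw [Subsingleton.elim i 0]
  exact h2

variable {e : OpenPartialHomeomorph M (Fin 2 → ℂ)} {s t : ℝ} {v : Fin 2 → ℂ}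

theorem holo_scaled (hv : fiberScale s v ∈ U) :
    ContMDiffAt 𝓘(ℂ, Fin 2 → ℂ) 𝓘(ℂ, Fin 2 → ℂ) ω (fun w => Ψ (fiberScale s w)) v :=
  (P.holo _ hv).comp v (contDiff_fiberScale s).contDiffAt.contMDiffAt

/-- The transition from a holomorphic chart to rescaled adapted coordinates is nondegenerate, since
`Ψ` has local inverses. -/
theorem isUnit_jac_chart (he : e ∈ holCharts 2 M) (hs : s ≠ 0) (hv : fiberScale s v ∈ U)
    (hve : Ψ (fiberScale s v) ∈ e.source) :
    IsUnit (jac (fun w => e (Ψ (fiberScale s w))) v).det := by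
  obtain ⟨Q, hQ, hQΨ, -⟩ := P.exists_inverse _ hv
  have hΦ := contDiffAt_chart_comp (f := fun w => Ψ (fiberScale s w)) he hve (P.holo_scaled hv)
  have hR : ContDiffAt ℂ ω (fun y => Q (e.symm y)) (e (Ψ (fiberScale s v))) := by
    refine contMDiffAt_iff_contDiffAt.1 (ContMDiffAt.comp _ ?_
      (contMDiffAt_symm_of_mem_maximalAtlas he (e.map_source hve)))
    rw [e.left_inv hve]
    exact hQ
  have hev : (fun w => Q (e.symm (e (Ψ (fiberScale s w))))) =ᶠ[𝓝 v] fiberScale s := by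
    filter_upwards [(P.holo_scaled hv).continuousAt.preimage_mem_nhds
      (e.open_source.mem_nhds hve), (contDiff_fiberScale s).continuous.continuousAt.eventually hQΨ]
      with w hw hw'
    rw [e.left_inv hw, hw']
  have h1 := jac_comp (Φ := fun y => Q (e.symm y)) (Ψ := fun w => e (Ψ (fiberScale s w)))
    (differentiableAt_of_omega hR) (differentiableAt_of_omega hΦ)
  rw [jac_congr hev, jac_fiberScale] at h1
  have h2 := congrArg Matrix.det h1
  rw [Matrix.det_mul, Matrix.det_fin_two_of] at h2
  rw [isUnit_iff_ne_zero]
  intro h0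
  rw [h0, mul_zero] at h2
  simp [hs] at h2

variable [IsManifold 𝓘(ℂ, Fin 2 → ℂ) ω M]

/-- The coefficient along the fibers of the flat form is constant on each fiber. -/
theorem wirt_flatForm_fiber [DiscreteTopology Λ] [IsZLattice ℝ Λ]
    (hρ : ContMDiff 𝓘(ℝ, Fin 2 → ℂ) 𝓘(ℝ, ℝ) ∞ ρ) (hflat : IsFlatOnFibers pr g₀ ρ)
    (hv : v ∈ U) : wirt 1 (fun w => flatForm g₀ ρ Ψ w 1 1) v = 0 := by
  have hholo : ∀ ζ, ContMDiffAt 𝓘(ℂ, Fin 1 → ℂ) 𝓘(ℂ, Fin 2 → ℂ) ω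
      (fun w => Ψ (fiberIncl (v 0) w)) ζ := fun ζ =>
    (P.holo _ (P.fiber_mem v hv ζ)).comp ζ (contDiff_fiberIncl (v 0)).contDiffAt.contMDiffAt
  have key := wirt_eq_zero_of_flat Λ (G := flatForm g₀ ρ fun w => Ψ (fiberIncl (v 0) w))
    (fun ζ => contDiffAt_flatForm g₀ hρ (hholo ζ) 0 0)
    (fun ζ => (P.flat_on_fiber hflat hv ζ).1) (fun ζ => (P.flat_on_fiber hflat hv ζ).2)
    (fun l hl ζ => by
      have h1 := flatForm_comp g₀ hρ (Φ := fun w => w + fun _ => l) (z := ζ) (hholo _)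
        (contDiff_id.add contDiff_const).contDiffAt
      rw [jac_add_const] at h1
      have h2 : (fun w => Ψ (fiberIncl (v 0) (w + fun _ => l))) =
          fun w => Ψ (fiberIncl (v 0) w) := funext fun w => P.periodic _ l hl w
      rw [h2] at h1
      rw [h1]
      simp) (fun _ => v 1)
  have h1 : (fun w => flatForm g₀ ρ (fun w => Ψ (fiberIncl (v 0) w)) w 0 0) =
      fun w => (fun w => flatForm g₀ ρ Ψ w 1 1) (fiberIncl (v 0) w) :=
    funext fun w => flatForm_fiberIncl hρ (P.holo _ (P.fiber_mem v hv w))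
  rw [h1, wirt_comp (Φ := fiberIncl (v 0)) (f := fun w => flatForm g₀ ρ Ψ w 1 1)
    (differentiableAt_of_contDiffAt
    (contDiffAt_flatForm g₀ hρ (P.holo _ (P.fiber_mem v hv _)) 1 1))
    (differentiableAt_of_omega (contDiff_fiberIncl _).contDiffAt), jac_fiberIncl,
    fiberIncl_self] at key
  simpa [Fin.sum_univ_two] using key

theorem flatForm_fiber_pos (hρ : ContMDiff 𝓘(ℝ, Fin 2 → ℂ) 𝓘(ℝ, ℝ) ∞ ρ)
    (hflat : IsFlatOnFibers pr g₀ ρ) (hv : v ∈ U) :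
    0 < flatForm g₀ ρ Ψ v 1 1 := by
  have h1 := (P.flat_on_fiber hflat hv fun _ => v 1).1.diag_pos (i := 0)
  rw [flatForm_fiberIncl hρ (P.holo _ (P.fiber_mem v hv _)), fiberIncl_self] at h1
  exact h1

/-- In the rescaled adapted coordinates the reference form at time `t`, with `s = e^{-t/2}`, is
given by `scaledForm`. -/
theorem scaledForm_eq (hpr : ContMDiff 𝓘(ℂ, Fin 2 → ℂ) 𝓘(ℂ, Fin 1 → ℂ) ω pr)
    (hρ : ContMDiff 𝓘(ℝ, Fin 2 → ℂ) 𝓘(ℝ, ℝ) ∞ ρ) (he : e ∈ holCharts 2 M) (hs : s ≠ 0)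
    (hst : Real.exp (-t) = s ^ 2) (hv : fiberScale s v ∈ U)
    (hve : Ψ (fiberScale s v) ∈ e.source) :
    scaledForm (flatForm g₀ ρ Ψ) (fun u => gS.pull c.symm (baseProj u) 0 0) s (fiberScale s v) =
      (jac (fun w => e (Ψ (fiberScale s w))) v).transpose *
        refForm pr g₀ ρ gS t e (e (Ψ (fiberScale s v))) *
        (jac (fun w => e (Ψ (fiberScale s w))) v).map (starRingEnd ℂ) := by
  set Φ : (Fin 2 → ℂ) → (Fin 2 → ℂ) := fun w => e (Ψ (fiberScale s w)) with hΦdef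
  have hΦ : ContDiffAt ℂ ω Φ v := contDiffAt_chart_comp (f := fun w => Ψ (fiberScale s w)) he hve
    (P.holo_scaled hv)
  have hsymm : ContMDiffAt 𝓘(ℂ, Fin 2 → ℂ) 𝓘(ℂ, Fin 2 → ℂ) ω e.symm (Φ v) :=
    contMDiffAt_symm_of_mem_maximalAtlas he (e.map_source hve)
  have hgerm : (fun w => Ψ (fiberScale s w)) =ᶠ[𝓝 v] fun w => e.symm (Φ w) :=
    eventuallyEq_symm_chart hve (P.holo_scaled hv).continuousAt
  have e1 : (jac Φ v).transpose * flatForm g₀ ρ e.symm (Φ v) * (jac Φ v).map (starRingEnd ℂ) =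
      (!![1, 0; 0, (s : ℂ)⁻¹] : Matrix _ _ ℂ).transpose * flatForm g₀ ρ Ψ (fiberScale s v) *
        (!![1, 0; 0, (s : ℂ)⁻¹] : Matrix _ _ ℂ).map (starRingEnd ℂ) := by
    rw [← flatForm_comp g₀ hρ hsymm hΦ, ← flatForm_congr g₀ hgerm,
      flatForm_comp g₀ hρ (P.holo _ hv) (contDiff_fiberScale s).contDiffAt, jac_fiberScale]
  have e2 : (jac Φ v).transpose * gS.pull (fun w => pr (e.symm w)) (Φ v) *
      (jac Φ v).map (starRingEnd ℂ) =
      (!![1, 0] : Matrix _ _ ℂ).transpose * gS.pull c.symm (baseProj v) *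
        (!![1, 0] : Matrix _ _ ℂ).map (starRingEnd ℂ) := by
    have hev : (fun w => pr (e.symm (Φ w))) =ᶠ[𝓝 v] fun w => c.symm (baseProj w) := by
      filter_upwards [hgerm, (contDiff_fiberScale s).continuous.continuousAt.preimage_mem_nhds
        (P.isOpen.mem_nhds hv)] with w hw hwU
      rw [← hw, P.proj _ hwU]
      rfl
    have hprs : ContMDiffAt 𝓘(ℂ, Fin 2 → ℂ) 𝓘(ℂ, Fin 1 → ℂ) ω (fun w => pr (e.symm w)) (Φ v) :=
      (hpr _).comp _ hsymm
    have hcv : baseProj v ∈ c.target := P.mem_target (fiberScale s v) hv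
    rw [← gS.pull_comp (f := fun w => pr (e.symm w)) (hprs.mdifferentiableAt (by simp))
      (differentiableAt_of_omega hΦ), gS.pull_congr hev,
      gS.pull_comp ((contMDiffAt_symm_of_mem_maximalAtlas P.chart hcv).mdifferentiableAt (by simp))
        (differentiableAt_of_omega contDiff_baseProj.contDiffAt), jac_baseProj]
  have hsC : (s : ℂ) ≠ 0 := Complex.ofReal_ne_zero.2 hs
  have hb : baseProj (fiberScale s v) = baseProj v := rfl
  rw [refForm, hst, Matrix.mul_add, Matrix.add_mul, Matrix.mul_smul, Matrix.smul_mul,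
    Matrix.mul_smul, Matrix.smul_mul, e1, e2]
  ext i j
  fin_cases i <;> fin_cases j <;>
    simp [scaledForm, Matrix.mul_apply, Fin.sum_univ_two, hb] <;> field_simp

/-- The reference metrics form a collapsing family in adapted coordinates. -/
theorem isCollapsing [DiscreteTopology Λ] [IsZLattice ℝ Λ]
    (hpr : ContMDiff 𝓘(ℂ, Fin 2 → ℂ) 𝓘(ℂ, Fin 1 → ℂ) ω pr)
    (hρ : ContMDiff 𝓘(ℝ, Fin 2 → ℂ) 𝓘(ℝ, ℝ) ∞ ρ) (hflat : IsFlatOnFibers pr g₀ ρ) {T : ℝ}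
    (hT : ∀ t : ℝ, T ≤ t → ∀ e ∈ holCharts 2 M, ∀ z ∈ e.target,
      (refForm pr g₀ ρ gS t e z).PosDef) :
    IsCollapsing (Real.exp (-T / 2)) U (flatForm g₀ ρ Ψ)
      (fun u => gS.pull c.symm (baseProj u) 0 0) where
  isOpen := P.isOpen
  smooth u hu i j := contDiffAt_flatForm g₀ hρ (P.holo u hu) i j
  smooth_base u hu := ContDiffAt.comp u (g := fun w => gS.pull c.symm w 0 0)
    ((gS.smooth c P.chart 0 0).contDiffAt (c.open_target.mem_nhds (P.mem_target u hu)))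
    (contDiffAt_real_of_complex contDiff_baseProj.contDiffAt)
  wirt_base u hu := by
    rw [wirt_comp (f := fun w => gS.pull c.symm w 0 0) (differentiableAt_of_contDiffAt
      ((gS.smooth c P.chart 0 0).contDiffAt (c.open_target.mem_nhds (P.mem_target u hu))))
      (differentiableAt_of_omega contDiff_baseProj.contDiffAt), jac_baseProj]
    simp
  wirt_fiber u hu := P.wirt_flatForm_fiber hρ hflat hu
  isUnit_det s hs u hu := by
    rcases hs.1.eq_or_lt with h0 | h0
    -- In the limit `s = 0` the matrix is diagonal with entries `σ` and `h₁₁`, both positive; for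
    -- `s > 0` it represents the reference form at the time `t = -2 log s`.
    · subst h0
      have h1 := (P.flatForm_fiber_pos hρ hflat hu).ne'
      have h2 : gS.pull c.symm (baseProj u) 0 0 ≠ 0 := fun h => by
        have := pull_symm_pos gS P.chart (P.mem_target u hu)
        rw [h] at this
        simp at this
      rw [isUnit_iff_ne_zero, scaledForm, Matrix.det_fin_two_of]
      simp [h1, h2]
    · have hsC : (s : ℂ) ≠ 0 := Complex.ofReal_ne_zero.2 h0.ne'
      have hu' : fiberScale s ![u 0, s * u 1] = u := by
        ext i
        fin_cases i
        · rfl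
        · simp [fiberScale, hsC]
      have hv : fiberScale s ![u 0, s * u 1] ∈ U := by rwa [hu']
      set e := chartAt (Fin 2 → ℂ) (Ψ (fiberScale s ![u 0, s * u 1]))
      have he : e ∈ holCharts 2 M := IsManifold.chart_mem_maximalAtlas _
      have hve : Ψ (fiberScale s ![u 0, s * u 1]) ∈ e.source := mem_chart_source _ _
      have hexp : Real.exp (-(-2 * Real.log s)) = s ^ 2 := by
        rw [neg_mul, neg_neg, two_mul, Real.exp_add, Real.exp_log h0, sq]
      have hTs : T ≤ -2 * Real.log s := by
        have := (Real.log_le_iff_le_exp h0).2 hs.2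
        linarith
      have hJ := P.isUnit_jac_chart he h0.ne' hv hve
      have h1 := P.scaledForm_eq (g₀ := g₀) (gS := gS) hpr hρ he h0.ne' hexp hv hve
      rw [hu'] at h1
      rw [h1, Matrix.det_mul, Matrix.det_mul, Matrix.det_transpose]
      refine (hJ.mul ?_).mul (isUnit_det_map_conj hJ)
      rw [hu'] at hve
      exact (Matrix.isUnit_iff_isUnit_det _).1
        (hT _ hTs e he _ (by rw [← hu'] at hve; rw [← hu']; exact e.map_source hve)).isUnit

end IsFiberParam

end Reference

/-! ### Uniform bounds -/

section Bounds

variable {M : Type*} [TopologicalSpace M] [ChartedSpace (Fin 2 → ℂ) M]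
  {S : Type*} [TopologicalSpace S] [ChartedSpace (Fin 1 → ℂ) S]
  {pr : M → S} {Λ : Submodule ℤ ℂ} {c : OpenPartialHomeomorph S (Fin 1 → ℂ)}
  {U : Set (Fin 2 → ℂ)} {Ψ : (Fin 2 → ℂ) → M} {g₀ : HermitianMetric 2 M} {ρ : M → ℝ}
  {gS : HermitianMetric 1 S}

/-- The estimates of the theorem with constant `C` for the metric with coefficients `G` at the
point `z` of a chart. -/
def SatisfiesBounds (C t : ℝ) (G : FormCoeff 2) (z : Fin 2 → ℂ) : Prop :=
  torsionNorm G z ≤ C ∧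
    dbarTorsionNorm G z + nablaTorsionNorm G z + curvatureNorm G z ≤ C * Real.exp (t / 2) ∧
    nablaBarDbarTorsionNorm G z + nablaDbarTorsionNorm G z ≤ C * Real.exp t

theorem SatisfiesBounds.mono {C D t : ℝ} {G : FormCoeff 2} {z : Fin 2 → ℂ}
    (h : SatisfiesBounds C t G z) (hCD : C ≤ D) : SatisfiesBounds D t G z :=
  ⟨h.1.trans hCD, h.2.1.trans (by gcongr), h.2.2.trans (by gcongr)⟩

/-- The six norms of the theorem do not depend on the coordinates. -/
theorem IsCoordChange.satisfiesBounds_iff {Φ : (Fin 2 → ℂ) → (Fin 2 → ℂ)} {V : Set (Fin 2 → ℂ)}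
    {G G' : FormCoeff 2} (h : IsCoordChange Φ V G G') {v : Fin 2 → ℂ} (hv : v ∈ V) (C t : ℝ) :
    SatisfiesBounds C t G (Φ v) ↔ SatisfiesBounds C t G' v := by
  have hT := isCoordTensor_torsion h
  unfold SatisfiesBounds torsionNorm dbarTorsionNorm nablaTorsionNorm curvatureNorm
    nablaBarDbarTorsionNorm nablaDbarTorsionNorm
  rw [hT.tensorNorm_eq h hv, (hT.nablaBar h).tensorNorm_eq h hv, (hT.nabla h).tensorNorm_eq h hv,
    (isCoordTensor_chernCurvature h).tensorNorm_eq h hv,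
    ((hT.nablaBar h).nablaBar h).tensorNorm_eq h hv, ((hT.nablaBar h).nabla h).tensorNorm_eq h hv]

/-- The estimates for a collapsing family, locally uniformly in the unscaled coordinates. -/
theorem IsCollapsing.exists_satisfiesBounds {b : ℝ} {h : FormCoeff 2} {σ : (Fin 2 → ℂ) → ℂ}
    (H : IsCollapsing b U h σ) {u : Fin 2 → ℂ} (hu : u ∈ U) :
    ∃ C : ℝ, ∀ᶠ w in 𝓝 u, ∀ s ∈ Set.Ioc 0 b, ∀ t, s = Real.exp (-t / 2) →
      ∀ v, fiberScale s v = w →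
        SatisfiesBounds C t (fun w => scaledForm h σ s (fiberScale s w)) v := by
  obtain ⟨C₁, h₁⟩ := H.exists_tensorNorm_bound (κ := torsionSlots) H.hasOrder_torsion hu
  obtain ⟨C₂, h₂⟩ := H.exists_tensorNorm_bound
    (κ := (Fin.cons .lowerBar torsionSlots : Fin 4 → Slot))
    (H.hasOrder_nablaBar (κ := torsionSlots) H.hasOrder_torsion) hu
  obtain ⟨C₃, h₃⟩ := H.exists_tensorNorm_bound
    (κ := (Fin.cons .lower torsionSlots : Fin 4 → Slot))
    (H.hasOrder_nabla (κ := torsionSlots) H.hasOrder_torsion) hu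
  obtain ⟨C₄, h₄⟩ := H.exists_tensorNorm_bound (κ := curvatureSlots) H.hasOrder_chernCurvature hu
  obtain ⟨C₅, h₅⟩ := H.exists_tensorNorm_bound
    (κ := (Fin.cons .lowerBar (Fin.cons .lowerBar torsionSlots : Fin 4 → Slot) : Fin 5 → Slot))
    (H.hasOrder_nablaBar (κ := (Fin.cons .lowerBar torsionSlots : Fin 4 → Slot))
      (H.hasOrder_nablaBar (κ := torsionSlots) H.hasOrder_torsion)) hu
  obtain ⟨C₆, h₆⟩ := H.exists_tensorNorm_bound
    (κ := (Fin.cons .lower (Fin.cons .lowerBar torsionSlots : Fin 4 → Slot) : Fin 5 → Slot))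
    (H.hasOrder_nabla (κ := (Fin.cons .lowerBar torsionSlots : Fin 4 → Slot))
      (H.hasOrder_nablaBar (κ := torsionSlots) H.hasOrder_torsion)) hu
  refine ⟨max C₁ (max (C₂ + C₃ + C₄) (C₅ + C₆)), ?_⟩
  filter_upwards [h₁, h₂, h₃, h₄, h₅, h₆] with w h₁ h₂ h₃ h₄ h₅ h₆ s hs t hst v hv
  replace h₁ := h₁ s hs v hv
  replace h₂ := h₂ s hs v hv
  replace h₃ := h₃ s hs v hv
  replace h₄ := h₄ s hs v hv
  replace h₅ := h₅ s hs v hv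
  replace h₆ := h₆ s hs v hv
  rw [zero_add, pow_one] at h₂ h₃
  rw [pow_one] at h₄
  rw [pow_zero, one_mul] at h₁
  rw [show 0 + 1 + 1 = 2 from rfl] at h₅ h₆
  have e1 : s * Real.exp (t / 2) = 1 := by
    rw [hst, ← Real.exp_add]; simp [neg_div]
  have e2 : s ^ 2 * Real.exp t = 1 := by
    rw [hst, ← Real.exp_nat_mul, ← Real.exp_add]
    rw [show ((2 : ℕ) : ℝ) * (-t / 2) + t = 0 by push_cast; ring, Real.exp_zero]
  set C := max C₁ (max (C₂ + C₃ + C₄) (C₅ + C₆))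
  have l1 : C₁ ≤ C := le_max_left _ _
  have l2 : C₂ + C₃ + C₄ ≤ C := (le_max_left _ _).trans (le_max_right _ _)
  have l3 : C₅ + C₆ ≤ C := (le_max_right _ _).trans (le_max_right _ _)
  have key1 : ∀ {x : ℝ}, s * x ≤ C → x ≤ C * Real.exp (t / 2) := fun {x} hx => by
    have := mul_le_mul_of_nonneg_right hx (Real.exp_pos (t / 2)).le
    rwa [mul_right_comm, e1, one_mul] at this
  have key2 : ∀ {x : ℝ}, s ^ 2 * x ≤ C → x ≤ C * Real.exp t := fun {x} hx => by
    have := mul_le_mul_of_nonneg_right hx (Real.exp_pos t).le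
    rwa [mul_right_comm, e2, one_mul] at this
  refine ⟨h₁.trans l1, key1 ?_, key2 ?_⟩
  · rw [mul_add, mul_add]
    exact (add_le_add (add_le_add h₂ h₃) h₄).trans l2
  · rw [mul_add]
    exact (add_le_add h₅ h₆).trans l3

variable [IsManifold 𝓘(ℂ, Fin 2 → ℂ) ω M]

theorem IsFiberParam.isCoordChange (P : IsFiberParam pr Λ c U Ψ)
    (hpr : ContMDiff 𝓘(ℂ, Fin 2 → ℂ) 𝓘(ℂ, Fin 1 → ℂ) ω pr)
    (hρ : ContMDiff 𝓘(ℝ, Fin 2 → ℂ) 𝓘(ℝ, ℝ) ∞ ρ) {e : OpenPartialHomeomorph M (Fin 2 → ℂ)}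
    (he : e ∈ holCharts 2 M) {s t : ℝ} (hs : s ≠ 0) (hst : Real.exp (-t) = s ^ 2)
    (hpos : ∀ z ∈ e.target, (refForm pr g₀ ρ gS t e z).PosDef) [IsManifold 𝓘(ℂ, Fin 1 → ℂ) ω S] :
    IsCoordChange (fun w => e (Ψ (fiberScale s w)))
      {v | fiberScale s v ∈ U ∧ Ψ (fiberScale s v) ∈ e.source} (refForm pr g₀ ρ gS t e)
      (fun w => scaledForm (flatForm g₀ ρ Ψ) (fun u => gS.pull c.symm (baseProj u) 0 0) s
        (fiberScale s w)) where
  isOpen := by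
    rw [isOpen_iff_mem_nhds]
    rintro v ⟨hv, hve⟩
    filter_upwards [(contDiff_fiberScale s).continuous.continuousAt.preimage_mem_nhds
      (P.isOpen.mem_nhds hv), (P.holo_scaled hv).continuousAt.preimage_mem_nhds
      (e.open_source.mem_nhds hve)] with w h1 h2 using ⟨h1, h2⟩
  holo v hv := contDiffAt_chart_comp (f := fun w => Ψ (fiberScale s w)) he hv.2
    (P.holo_scaled hv.1)
  isUnit_jac v hv := P.isUnit_jac_chart he hs hv.1 hv.2
  smooth v hv i j := by
    have hsymm : ContMDiffAt 𝓘(ℂ, Fin 2 → ℂ) 𝓘(ℂ, Fin 2 → ℂ) ω e.symm (e (Ψ (fiberScale s v))) :=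
      contMDiffAt_symm_of_mem_maximalAtlas he (e.map_source hv.2)
    exact (contDiffAt_const.mul (contDiffAt_flatForm g₀ hρ hsymm i j)).add
      (contDiffAt_const.mul (gS.contDiffAt_pull (f := fun w => pr (e.symm w))
        ((hpr _).comp _ hsymm) i j))
  isUnit_det v hv :=
    (Matrix.isUnit_iff_isUnit_det _).1 (hpos _ (e.map_source hv.2)).isUnit
  eq v hv := P.scaledForm_eq hpr hρ he hs hst hv.1 hv.2

/-- The estimates hold uniformly near each point of an elliptic bundle. -/
theorem IsFiberParam.exists_satisfiesBounds [DiscreteTopology Λ] [IsZLattice ℝ Λ]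
    [IsManifold 𝓘(ℂ, Fin 1 → ℂ) ω S] (P : IsFiberParam pr Λ c U Ψ)
    (hpr : ContMDiff 𝓘(ℂ, Fin 2 → ℂ) 𝓘(ℂ, Fin 1 → ℂ) ω pr)
    (hρ : ContMDiff 𝓘(ℝ, Fin 2 → ℂ) 𝓘(ℝ, ℝ) ∞ ρ) (hflat : IsFlatOnFibers pr g₀ ρ) {T : ℝ}
    (hT : ∀ t : ℝ, T ≤ t → ∀ e ∈ holCharts 2 M, ∀ z ∈ e.target,
      (refForm pr g₀ ρ gS t e z).PosDef) {u : Fin 2 → ℂ} (hu : u ∈ U) :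
    ∃ C : ℝ, ∀ᶠ x in 𝓝 (Ψ u), ∀ t, T ≤ t → ∀ e ∈ holCharts 2 M, x ∈ e.source →
      SatisfiesBounds C t (refForm pr g₀ ρ gS t e) (e x) := by
  obtain ⟨C, hC⟩ := (P.isCollapsing hpr hρ hflat hT).exists_satisfiesBounds hu
  obtain ⟨Q, hQ, hQΨ, hΨQ⟩ := P.exists_inverse u hu
  have hQu : Q (Ψ u) = u := hQΨ.self_of_nhds
  have hQt : Filter.Tendsto Q (𝓝 (Ψ u)) (𝓝 u) := by
    have := hQ.continuousAt.tendsto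
    rwa [hQu] at this
  refine ⟨C, ?_⟩
  filter_upwards [hQt.eventually hC, hQt.eventually (P.isOpen.mem_nhds hu), hΨQ]
    with x hx hxU hxQ t ht e he hxe
  set s := Real.exp (-t / 2) with hs
  have hs0 : 0 < s := Real.exp_pos _
  have hsC : (s : ℂ) ≠ 0 := Complex.ofReal_ne_zero.2 hs0.ne'
  have hst : Real.exp (-t) = s ^ 2 := by
    rw [hs, ← Real.exp_nat_mul]
    congr 1
    push_cast
    ring
  have hv : fiberScale s ![Q x 0, s * Q x 1] = Q x := by
    ext i
    fin_cases i
    · rfl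
    · simp [fiberScale, hsC]
  have hsb : s ∈ Set.Ioc 0 (Real.exp (-T / 2)) :=
    ⟨hs0, Real.exp_le_exp.2 (by linarith)⟩
  have h1 := hx s hsb t hs _ hv
  have h2 := P.isCoordChange (g₀ := g₀) (gS := gS) hpr hρ he hs0.ne' hst (hT t ht e he)
  have hxe' : Ψ (Q x) ∈ e.source := by rwa [hxQ]
  have h3 := (h2.satisfiesBounds_iff (v := ![Q x 0, s * Q x 1])
    ⟨by rw [hv]; exact hxU, by rw [hv]; exact hxe'⟩ C t).2 h1
  rw [hv, hxQ] at h3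
  exact h3

end Bounds

end CollapsingSurfaces

end

theorem lemma4p1
    {M : Type*} [TopologicalSpace M] [T2Space M] [CompactSpace M]
    [ChartedSpace (Fin 2 → ℂ) M] [IsManifold 𝓘(ℂ, Fin 2 → ℂ) ω M]
    {S : Type*} [TopologicalSpace S] [T2Space S] [CompactSpace S] [ConnectedSpace S]
    [ChartedSpace (Fin 1 → ℂ) S] [IsManifold 𝓘(ℂ, Fin 1 → ℂ) ω S]
    {E : Type*} [TopologicalSpace E] [T2Space E] [ChartedSpace ℂ E] [IsManifold 𝓘(ℂ, ℂ) ω E]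
    (pr : M → S) (hpr : IsEllipticBundle E pr)
    (gS : HermitianMetric 1 S) (hgS : gS.RicciEqNeg)
    (g₀ : HermitianMetric 2 M) (hg₀ : g₀.DdbarClosed)
    (ρ : M → ℝ) (hρ : ContMDiff 𝓘(ℝ, Fin 2 → ℂ) 𝓘(ℝ, ℝ) ∞ ρ)
    (hflat : IsFlatOnFibers pr g₀ ρ)
    (T_I : ℝ)
    (hT_I : ∀ t : ℝ, T_I ≤ t → ∀ e ∈ holCharts 2 M, ∀ z ∈ e.target,
      (refForm pr g₀ ρ gS t e z).PosDef) :
    ∃ C : ℝ, ∀ t : ℝ, T_I ≤ t → ∀ e ∈ holCharts 2 M, ∀ z ∈ e.target,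
      torsionNorm (refForm pr g₀ ρ gS t e) z ≤ C ∧
      dbarTorsionNorm (refForm pr g₀ ρ gS t e) z + nablaTorsionNorm (refForm pr g₀ ρ gS t e) z
        + curvatureNorm (refForm pr g₀ ρ gS t e) z ≤ C * Real.exp (t / 2) ∧
      nablaBarDbarTorsionNorm (refForm pr g₀ ρ gS t e) z
        + nablaDbarTorsionNorm (refForm pr g₀ ρ gS t e) z ≤ C * Real.exp t := by
  have hprs : ContMDiff 𝓘(ℂ, Fin 2 → ℂ) 𝓘(ℂ, Fin 1 → ℂ) ω pr := fun x => contMDiffAt_pr hpr x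
  obtain ⟨Λ, _, _, hparam⟩ := exists_isFiberParam hpr
  have hcomp : ∃ C : ℝ, ∀ x ∈ (Set.univ : Set M), ∀ t, T_I ≤ t → ∀ e ∈ holCharts 2 M,
      x ∈ e.source → SatisfiesBounds C t (refForm pr g₀ ρ gS t e) (e x) := by
    refine isCompact_univ.induction_on (p := fun K : Set M => ∃ C : ℝ, ∀ x ∈ K, ∀ t, T_I ≤ t →
      ∀ e ∈ holCharts 2 M, x ∈ e.source →
        SatisfiesBounds C t (refForm pr g₀ ρ gS t e) (e x)) ⟨0, by simp⟩ ?_ ?_ ?_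
    · rintro K L hKL ⟨C, hC⟩
      exact ⟨C, fun x hx => hC x (hKL hx)⟩
    · rintro K L ⟨C, hC⟩ ⟨D, hD⟩
      refine ⟨max C D, fun x hx t ht e he hxe => ?_⟩
      rcases hx with hx | hx
      · exact (hC x hx t ht e he hxe).mono (le_max_left _ _)
      · exact (hD x hx t ht e he hxe).mono (le_max_right _ _)
    · intro x _
      obtain ⟨c, U, Ψ, P, u, hu, rfl⟩ := hparam x
      obtain ⟨C, hC⟩ := P.exists_satisfiesBounds hprs hρ hflat hT_I hu
      exact ⟨_, mem_nhdsWithin_of_mem_nhds hC, C, fun x hx => hx⟩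
  obtain ⟨C, hC⟩ := hcomp
  refine ⟨C, fun t ht e he z hz => ?_⟩
  have := hC (e.symm z) trivial t ht e he (e.map_target hz)
  rwa [e.right_inv hz] at this
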